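/- Let $p$ be a prime, let $G=\operatorname{Spec}\mathcal{O}(G)$ be a flat affine group scheme of finite type over $\mathbb{Z}_p$, let $k_0$ be a finite field of characteristic $p$, and let $\mu:\mathbb{G}_{m,W(k_0)}\to G_{W(k_0)}$ be a cocharacter defined over the ring $W(k_0)$ of $p$-typical Witt vectors. **The graded Witt ring.** For a ring $R$ with Witt ring $W(R)$, Frobenius $f$, Verschiebung $v$ and $I_R=v(W(R))$, let $W(R)^\oplus=\bigoplus_{n\in\mathbb{Z}}W(R)^\oplus_n$ be the graded ring with $\bigoplus_{n\le 0}W(R)^\oplus_n=W(R)[t]$, $\deg t=-1$, and $W(R)^\oplus_n=I_R$ for $n\ge 1$, where the product $I_R\times I_R\to I_R$ in positive degrees is $(v(a),v(b))\mapsto v(ab)$, elements of $W(R)$ in degree $0$ act on $I_R$ by multiplication, and multiplication by $t$ is the inclusion $I_R\subset W(R)$ from degree $1$ to degree $0$ and multiplication by $p$ from degree $n+1$ to degree $n$ for $n\ge 1$. For a $W(k_0)$-algebra $R$, the ring $W(R)^\oplus$ is a graded $W(k_0)$-algebra through $W(k_0)\xrightarrow{\Delta}W(W(k_0))\to W(R)=W(R)^\oplus_0$,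 where $\Delta$ is the Cartier homomorphism (the Witt vector $\Delta(x)$ has ghost components $x,f(x),f^2(x),\dots$). **The display group.** Let $A=W(k_0)\otimes_{\mathbb{Z}_p}\mathcal{O}(G)$ be the coordinate ring of $G_{W(k_0)}$, graded by letting $A_n$ be the set of all $a\in A$ such that $a(\mu(\lambda)^{-1}g\mu(\lambda))=\lambda^n a(g)$ for every $W(k_0)$-algebra $B$, $\lambda\in B^\times$ and $g\in G(B)$. For a $\mathbb{Z}$-graded $W(k_0)$-algebra $S$, the homomorphisms of $W(k_0)$-algebras $A\to S$ that preserve the gradings form a subgroup $G(S)_\mu$ of $G(S)$. The display group is the functor $R\mapsto L^+_\mu G(R):=G(W(R)^\oplus)_\mu$ on $W(k_0)$-algebras. **The canonical graded fiber functor.** Let $\mathbf{Rep}_{\mathbb{Z}_p}(G)$ be the category of representations $(V,\rho)$ of $G$ on finite free $\mathbb{Z}_p$-modules. For such $(V,\rho)$ put $V_{W(k_0)}=V\otimes_{\mathbb{Z}_p}W(k_0)$ and let $V^i_{W(k_0)}\subset V_{W(k_0)}$ be the piece of weight $i$ for $\rho\circ\mu$, that is, the set of all $w$ with $\rho(\mu(z))w=z^iw$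 for every $W(k_0)$-algebra $B$ and every $z\in B^\times$. For a $W(k_0)$-algebra $R$ the tensor functor $\mathscr{C}_{\mu,R}$ sends $(V,\rho)$ to the graded $W(R)^\oplus$-module $V_{W(k_0)}\otimes_{W(k_0)}W(R)^\oplus$, whose piece of degree $l$ is generated as a $W(k_0)$-module by the elements $w\otimes s$ with $w\in V^i_{W(k_0)}$ and $s\in W(R)^\oplus_{l-i}$, $i\in\mathbb{Z}$. An element of $\operatorname{Aut}^\otimes(\mathscr{C}_{\mu,R})$ is a family $(\lambda_V)$ of automorphisms of the graded $W(R)^\oplus$-modules $\mathscr{C}_{\mu,R}(V,\rho)$, one for each $(V,\rho)$, that is natural in $(V,\rho)$, compatible with tensor products, and the identity on the unit object. As $R$ varies, base change along $W(R)^\oplus\to W(R')^\oplus$ makes this a functor $\underline{\operatorname{Aut}}^\otimes(\mathscr{C}_\mu)$ from $W(k_0)$-algebras to groups. **Theorem.** The restrictions of $L^+_\mu G$ and $\underline{\operatorname{Aut}}^\otimes(\mathscr{C}_\mu)$ to the category of $W(k_0)$-algebras in which $p$ is nilpotent are sheaves of groups for the fpqc topology. For every $W(k_0)$-algebra $R$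 and every $h\in L^+_\mu G(R)$ the family $\{\rho(h)\}_{(V,\rho)}$ lies in $\operatorname{Aut}^\otimes(\mathscr{C}_{\mu,R})$, and $$\Psi: L^+_\mu G\to\underline{\operatorname{Aut}}^\otimes(\mathscr{C}_\mu),\qquad h\mapsto\{\rho(h)\}_{(V,\rho)},$$ is an isomorphism: for every $W(k_0)$-algebra $R$ it is an isomorphism of groups $L^+_\mu G(R)\cong\operatorname{Aut}^\otimes(\mathscr{C}_{\mu,R})$, natural in $R$. In particular it is an isomorphism of fpqc sheaves of groups on $p$-nilpotent $W(k_0)$-algebras. -/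

import Mathlib

open scoped TensorProduct LaurentPolynomial DirectSum

noncomputable section

namespace GDisplay

/-! ### Graded rings given by additive subgroups of an auxiliary ring -/

section InternalSum

variable {P Q Q' Q'' : Type*} [CommRing P] [CommRing Q] [CommRing Q'] [CommRing Q'']
variable (A : ℤ → AddSubgroup Q) [SetLike.GradedMonoid A]
variable (A' : ℤ → AddSubgroup Q') [SetLike.GradedMonoid A']

/-- A ring homomorphism into the degree zero piece, as a homomorphism into the direct sum. -/
def sumOfZero (g : P →+* Q) (hg : ∀ x, g x ∈ A 0) : P →+* ⨁ n, A n where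
  toFun x := DirectSum.of (fun n => A n) 0 ⟨g x, hg x⟩
  map_one' := congrArg (DirectSum.of (fun n => A n) 0) (Subtype.ext (map_one g))
  map_mul' x y := by
    rw [DirectSum.of_mul_of]
    exact DirectSum.of_eq_of_gradedMonoid_eq
      (Sigma.subtype_ext (zero_add 0).symm (map_mul g x y))
  map_zero' := by
    rw [← map_zero (DirectSum.of (fun n => A n) 0)]
    exact congrArg (DirectSum.of (fun n => A n) 0) (Subtype.ext (map_zero g))
  map_add' x y := by
    rw [← map_add (DirectSum.of (fun n => A n) 0)]
    exact congrArg (DirectSum.of (fun n => A n) 0) (Subtype.ext (map_add g x y))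

/-- The homomorphism of direct sums that is induced by a ring homomorphism which respects the
pieces. -/
def sumMap (g : Q →+* Q') (hg : ∀ n, ∀ x ∈ A n, g x ∈ A' n) : (⨁ n, A n) →+* ⨁ n, A' n :=
  DirectSum.toSemiring
    (fun n => (DirectSum.of (fun n => A' n) n).comp
      ((g.toAddMonoidHom.comp (A n).subtype).codRestrict (A' n) fun x => hg n x x.2))
    (congrArg (DirectSum.of (fun n => A' n) 0) (Subtype.ext (map_one g)))
    (fun {i j} x y => by
      refine Eq.trans ?_ (DirectSum.of_mul_of _ _).symm
      exact congrArg (DirectSum.of (fun n => A' n) (i + j)) (Subtype.ext (map_mul g x.1 y.1)))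

theorem sumMap_of (g : Q →+* Q') (hg : ∀ n, ∀ x ∈ A n, g x ∈ A' n) (n : ℤ) (x : A n) :
    sumMap A A' g hg (DirectSum.of (fun n => A n) n x) =
      DirectSum.of (fun n => A' n) n ⟨g x, hg n x x.2⟩ :=
  DirectSum.toSemiring_of _ _ _ _ _

/-- The piece of degree `n`, as an additive subgroup of the direct sum. -/
def sumDeg (n : ℤ) : AddSubgroup (⨁ n, A n) := (DirectSum.of (fun n => A n) n).range

theorem sumDeg_mul_mem {i j : ℤ} {x y : ⨁ n, A n} (hx : x ∈ sumDeg A i) (hy : y ∈ sumDeg A j) :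
    x * y ∈ sumDeg A (i + j) := by
  obtain ⟨x, rfl⟩ := hx
  obtain ⟨y, rfl⟩ := hy
  classical
  rw [DirectSum.of_mul_of]
  exact ⟨_, rfl⟩

theorem sumDeg_iSup : ⨆ n, sumDeg A n = ⊤ := by
  refine eq_top_iff.2 fun x _ => ?_
  induction x using DirectSum.induction_on with
  | zero => exact zero_mem _
  | of n x => exact AddSubgroup.mem_iSup_of_mem n ⟨x, rfl⟩
  | add x y hx hy => exact add_mem (hx trivial) (hy trivial)

end InternalSum

/-! ### The graded Witt ring -/

section GradedWitt

variable (p : ℕ) [hp : Fact p.Prime] (R : Type*) [CommRing R]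

open WittVector

/-- The pair `(τ s, σ s)` for the element `s` of degree `m + 1` of the graded Witt ring that is
given by `v(a) ∈ I_R`: here `τ s = p ^ m * v(a)` and `σ s = a`. -/
def posElt (m : ℕ) : WittVector p R →+ WittVector p R × WittVector p R where
  toFun a := ((p : WittVector p R) ^ m * verschiebung a, a)
  map_zero' := by simp
  map_add' a b := by simp [mul_add]

/-- The pair `(τ s, σ s)` for the element `s = x * t ^ m` of degree `-m` of the graded Witt ring:
here `τ s = x` and `σ s = p ^ m * f(x)`. -/
def negElt (m : ℕ) : WittVector p R →+ WittVector p R × WittVector p R where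
  toFun x := (x, (p : WittVector p R) ^ m * frobenius x)
  map_zero' := by simp
  map_add' a b := by simp [mul_add]

/-- The homogeneous pieces of the graded Witt ring `W(R)^⊕`: the piece of degree `n ≥ 1` is a copy
of `I_R = v(W(R))`, the piece of degree `-m ≤ 0` is a copy `W(R) * t ^ m` of `W(R)`. Since the pair
`(τ, σ)` is injective on every homogeneous piece, a homogeneous element `s` is recorded by the pair
`(τ s, σ s)`, so that products are computed componentwise in `W(R) × W(R)`. -/
def wittPiece : ℤ → AddSubgroup (WittVector p R × WittVector p R)
  | Int.ofNat 0 => (negElt p R 0).range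
  | Int.ofNat (m + 1) => (posElt p R m).range
  | Int.negSucc m => (negElt p R (m + 1)).range

variable {p R}

theorem posElt_apply (m : ℕ) (a : WittVector p R) :
    posElt p R m a = ((p : WittVector p R) ^ m * verschiebung a, a) := rfl

theorem negElt_apply (m : ℕ) (x : WittVector p R) :
    negElt p R m x = (x, (p : WittVector p R) ^ m * frobenius x) := rfl

theorem posElt_mem {n : ℤ} (m : ℕ) (h : n = m + 1) (a : WittVector p R) :
    posElt p R m a ∈ wittPiece p R n := by
  subst h
  exact ⟨a, rfl⟩

theorem negElt_mem {n : ℤ} (m : ℕ) (h : n = -m) (x : WittVector p R) :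
    negElt p R m x ∈ wittPiece p R n := by
  subst h
  cases m with
  | zero => exact ⟨x, rfl⟩
  | succ m => exact ⟨x, rfl⟩

theorem mem_wittPiece_cases {n : ℤ} {s : WittVector p R × WittVector p R}
    (hs : s ∈ wittPiece p R n) :
    (∃ (m : ℕ) (a : WittVector p R), n = m + 1 ∧ s = posElt p R m a) ∨
      ∃ (m : ℕ) (x : WittVector p R), n = -m ∧ s = negElt p R m x := by
  match n, hs with
  | Int.ofNat 0, ⟨x, hx⟩ => exact Or.inr ⟨0, x, rfl, hx.symm⟩
  | Int.ofNat (m + 1), ⟨a, ha⟩ => exact Or.inl ⟨m, a, rfl, ha.symm⟩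
  | Int.negSucc m, ⟨x, hx⟩ => exact Or.inr ⟨m + 1, x, by simp [Int.negSucc_eq], hx.symm⟩

theorem verschiebung_pow_mul (m : ℕ) (a : WittVector p R) :
    verschiebung ((p : WittVector p R) ^ m * a) = (p : WittVector p R) ^ m * verschiebung a := by
  rw [← Nat.cast_pow, ← nsmul_eq_mul, ← nsmul_eq_mul, map_nsmul]

theorem verschiebung_mul_verschiebung (a b : WittVector p R) :
    verschiebung a * verschiebung b = (p : WittVector p R) * verschiebung (a * b) := by
  have h := verschiebung_pow_mul 1 (a * b)
  rw [pow_one] at h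
  rw [← verschiebung_mul_frobenius, frobenius_verschiebung, ← h, ← mul_assoc,
    mul_comm (p : WittVector p R)]

/-- In positive degrees the product is `v(a) * v(b) = v(a * b)`. -/
theorem posElt_mul_posElt (m n : ℕ) (a b : WittVector p R) :
    posElt p R m a * posElt p R n b = posElt p R (m + n + 1) (a * b) := by
  rw [posElt_apply, posElt_apply, posElt_apply, Prod.mk_mul_mk, mul_mul_mul_comm,
    verschiebung_mul_verschiebung, ← mul_assoc, ← pow_add, ← pow_succ]

/-- In degrees at most zero the product is that of `W(R)[t]`. -/
theorem negElt_mul_negElt (m n : ℕ) (x y : WittVector p R) :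
    negElt p R m x * negElt p R n y = negElt p R (m + n) (x * y) := by
  rw [negElt_apply, negElt_apply, negElt_apply, Prod.mk_mul_mk, mul_mul_mul_comm, ← pow_add,
    ← map_mul]

/-- For `n ≤ m` the product of `v(a)` in degree `m + 1` with `x * t ^ n` is `p ^ n * v(a) * x`
in degree `m - n + 1`. -/
theorem posElt_mul_negElt_of_le {m n : ℕ} (h : n ≤ m) (a x : WittVector p R) :
    posElt p R m a * negElt p R n x =
      posElt p R (m - n) ((p : WittVector p R) ^ n * (a * frobenius x)) := by
  rw [posElt_apply, negElt_apply, posElt_apply, Prod.mk_mul_mk, verschiebung_pow_mul,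
    verschiebung_mul_frobenius, ← mul_assoc (_ ^ (m - n)), ← pow_add, Nat.sub_add_cancel h,
    mul_assoc, mul_left_comm a]

/-- For `m < n` the product of `v(a)` in degree `m + 1` with `x * t ^ n` is
`p ^ m * v(a) * x * t ^ (n - m - 1)`. -/
theorem posElt_mul_negElt_of_lt {m n : ℕ} (h : m < n) (a x : WittVector p R) :
    posElt p R m a * negElt p R n x =
      negElt p R (n - (m + 1)) ((p : WittVector p R) ^ m * (verschiebung a * x)) := by
  obtain ⟨d, rfl⟩ := Nat.exists_eq_add_of_lt h
  rw [show m + d + 1 - (m + 1) = d by omega, posElt_apply, negElt_apply, negElt_apply,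
    Prod.mk_mul_mk, mul_assoc, map_mul, map_mul, map_pow, map_natCast, frobenius_verschiebung]
  congr 1
  ring

instance wittPiece_gradedMonoid : SetLike.GradedMonoid (wittPiece p R) where
  one_mem := ⟨1, by rw [negElt_apply, map_one, mul_one, pow_zero, Prod.mk_one_one]⟩
  mul_mem := by
    have key : ∀ (m n : ℕ) (a x : WittVector p R),
        posElt p R m a * negElt p R n x ∈ wittPiece p R ((m + 1 : ℤ) + -n) := by
      intro m n a x
      rcases le_or_gt n m with h | h
      · rw [posElt_mul_negElt_of_le h]
        exact posElt_mem _ (by omega) _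
      · rw [posElt_mul_negElt_of_lt h]
        exact negElt_mem _ (by omega) _
    intro i j s s' hs hs'
    rcases mem_wittPiece_cases hs with ⟨m, a, rfl, rfl⟩ | ⟨m, x, rfl, rfl⟩ <;>
    rcases mem_wittPiece_cases hs' with ⟨n, b, rfl, rfl⟩ | ⟨n, y, rfl, rfl⟩
    · rw [posElt_mul_posElt]
      exact posElt_mem _ (by push_cast; ring) _
    · exact key _ _ _ _
    · rw [mul_comm, add_comm]
      exact key _ _ _ _
    · rw [negElt_mul_negElt]
      exact negElt_mem _ (by push_cast; ring) _


variable (p R) in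
/-- The graded Witt ring `W(R)^⊕`. -/
def GradedWitt : Type _ := ⨁ n : ℤ, wittPiece p R n

instance : CommRing (GradedWitt p R) :=
  inferInstanceAs (CommRing (⨁ n : ℤ, wittPiece p R n))

variable (p R) in
/-- The inclusion of `W(R)` into `W(R)^⊕` as the piece of degree zero. -/
def GradedWitt.ofWitt : WittVector p R →+* GradedWitt p R :=
  sumOfZero (wittPiece p R) ((RingHom.id _).prod frobenius) fun x =>
    ⟨x, by rw [negElt_apply, pow_zero, one_mul, RingHom.prod_apply, RingHom.id_apply]⟩

variable (p R) in
/-- The piece of degree `n` of `W(R)^⊕`. -/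
def GradedWitt.deg (n : ℤ) : AddSubgroup (GradedWitt p R) := sumDeg (wittPiece p R) n

theorem map_frobenius {R' : Type*} [CommRing R'] (φ : R →+* R') (x : WittVector p R) :
    WittVector.map φ (frobenius x) = frobenius (WittVector.map φ x) := by
  ext n
  rw [WittVector.map_coeff, coeff_frobenius, coeff_frobenius]
  exact MvPolynomial.comp_aeval_apply x.coeff φ.toIntAlgHom (frobeniusPoly p n)

theorem prodMap_mem_wittPiece {R' : Type*} [CommRing R'] (φ : R →+* R') (n : ℤ)
    (s : WittVector p R × WittVector p R) (hs : s ∈ wittPiece p R n) :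
    RingHom.prodMap (WittVector.map φ) (WittVector.map φ) s ∈ wittPiece p R' n := by
  rcases mem_wittPiece_cases hs with ⟨m, a, h, rfl⟩ | ⟨m, x, h, rfl⟩
  · have : RingHom.prodMap (WittVector.map φ) (WittVector.map φ) (posElt p R m a) =
        posElt p R' m (WittVector.map φ a) := by
      simp [posElt_apply]
    rw [this]
    exact posElt_mem m h _
  · have : RingHom.prodMap (WittVector.map φ) (WittVector.map φ) (negElt p R m x) =
        negElt p R' m (WittVector.map φ x) := by
      simp [negElt_apply, map_frobenius]
    rw [this]
    exact negElt_mem m h _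

variable (p) in
/-- The homomorphism `W(R)^⊕ → W(R')^⊕` induced by a ring homomorphism `R → R'`. -/
def GradedWitt.map {R' : Type*} [CommRing R'] (φ : R →+* R') :
    GradedWitt p R →+* GradedWitt p R' :=
  sumMap (wittPiece p R) (wittPiece p R')
    (RingHom.prodMap (WittVector.map φ) (WittVector.map φ)) (prodMap_mem_wittPiece φ)

end GradedWitt

/-! ### The Cartier homomorphism -/

section Cartier

open WittVector

variable (p : ℕ) [hp : Fact p.Prime] {B : Type*} [CommRing B]

variable {p} in
theorem ghostComponent_eq_sum (x : WittVector p B) (n : ℕ) :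
    ghostComponent n x = ∑ i ∈ Finset.range (n + 1), (p : B) ^ i * x.coeff i ^ p ^ (n - i) := by
  rw [ghostComponent_apply, aeval_wittPolynomial]

variable {p} in
theorem ext_ghost (hB : ∀ x : B, (p : B) * x = 0 → x = 0) {x y : WittVector p B}
    (h : ∀ n, ghostComponent n x = ghostComponent n y) : x = y := by
  have hB' : ∀ (n : ℕ) (x : B), (p : B) ^ n * x = 0 → x = 0 := by
    intro n
    induction n with
    | zero => intro x hx; simpa using hx
    | succ n ih =>
      intro x hx
      exact hB x (ih _ (by rw [← mul_assoc, ← pow_succ]; exact hx))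
  ext n
  induction n using Nat.strong_induction_on with
  | _ n ih =>
    have hn := h n
    rw [ghostComponent_eq_sum, ghostComponent_eq_sum, Finset.sum_range_succ,
      Finset.sum_range_succ, Finset.sum_congr rfl fun i hi => by rw [ih i (Finset.mem_range.1 hi)],
      Nat.sub_self, pow_zero, pow_one, pow_one, add_right_inj] at hn
    exact sub_eq_zero.1 (hB' n _ (by rw [mul_sub, hn, sub_self]))

/-- The components of the Witt vector with ghost components `b, φ b, φ (φ b), …`. -/
def dworkCoeff (φ : B →+* B) (b : B) (n : ℕ) : B :=
  Classical.epsilon fun c : B =>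
    ∑ i : Fin n, (p : B) ^ (i : ℕ) * dworkCoeff φ b i ^ p ^ (n - i) + (p : B) ^ n * c = φ^[n] b
termination_by n
decreasing_by exact i.2

set_option linter.unusedSectionVars false in
theorem dworkCoeff_spec (φ : B →+* B) (hφ : ∀ x, (p : B) ∣ φ x - x ^ p) (b : B) (n : ℕ) :
    ∑ i ∈ Finset.range (n + 1), (p : B) ^ i * dworkCoeff p φ b i ^ p ^ (n - i) = φ^[n] b := by
  induction n using Nat.strong_induction_on with
  | _ n ih =>
    have key : ∃ c : B, ∑ i : Fin n, (p : B) ^ (i : ℕ) * dworkCoeff p φ b i ^ p ^ (n - i) +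
        (p : B) ^ n * c = φ^[n] b := by
      cases n with
      | zero => exact ⟨b, by simp⟩
      | succ k =>
        have hdvd : (p : B) ^ (k + 1) ∣ φ^[k + 1] b -
            ∑ i ∈ Finset.range (k + 1), (p : B) ^ i * dworkCoeff p φ b i ^ p ^ (k + 1 - i) := by
          rw [Function.iterate_succ_apply', ← ih k (Nat.lt_succ_self k), map_sum,
            ← Finset.sum_sub_distrib]
          refine Finset.dvd_sum fun i hi => ?_
          have hi' : i ≤ k := Nat.lt_succ_iff.1 (Finset.mem_range.1 hi)
          rw [map_mul, map_pow, map_natCast, map_pow, ← mul_sub,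
            show k + 1 = i + (k - i + 1) by omega, pow_add,
            show i + (k - i + 1) - i = (k - i) + 1 by omega, pow_succ' p (k - i), pow_mul]
          exact mul_dvd_mul_left _ (dvd_sub_pow_of_dvd_sub (hφ _) _)
        obtain ⟨c, hc⟩ := hdvd
        refine ⟨c, ?_⟩
        rw [← hc, Fin.sum_univ_eq_sum_range
          (fun i => (p : B) ^ i * dworkCoeff p φ b i ^ p ^ (k + 1 - i))]
        ring
    have h := Classical.epsilon_spec key
    rw [← dworkCoeff, Fin.sum_univ_eq_sum_range
      (fun i => (p : B) ^ i * dworkCoeff p φ b i ^ p ^ (n - i))] at h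
    rw [Finset.sum_range_succ, Nat.sub_self, pow_zero, pow_one]
    exact h

/-- For a ring `B` without `p`-torsion and a lift `φ` of Frobenius, the ring homomorphism
`B → W(B)` that sends `b` to the Witt vector with ghost components `b, φ b, φ (φ b), …`. -/
def dwork (hB : ∀ x : B, (p : B) * x = 0 → x = 0) (φ : B →+* B)
    (hφ : ∀ x, (p : B) ∣ φ x - x ^ p) : B →+* WittVector p B :=
  have hg : ∀ b n, ghostComponent n (WittVector.mk p (dworkCoeff p φ b)) = φ^[n] b := fun b n => by
    rw [ghostComponent_eq_sum]
    exact dworkCoeff_spec p φ hφ b n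
  { toFun := fun b => WittVector.mk p (dworkCoeff p φ b)
    map_one' := ext_ghost hB fun n => by rw [hg, map_one, iterate_map_one]
    map_mul' := fun x y => ext_ghost hB fun n => by rw [map_mul, hg, hg, hg, iterate_map_mul]
    map_zero' := ext_ghost hB fun n => by rw [hg, map_zero, iterate_map_zero]
    map_add' := fun x y => ext_ghost hB fun n => by rw [map_add, hg, hg, hg, iterate_map_add] }

theorem ghostComponent_dwork (hB : ∀ x : B, (p : B) * x = 0 → x = 0) (φ : B →+* B)
    (hφ : ∀ x, (p : B) ∣ φ x - x ^ p) (n : ℕ) (b : B) :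
    ghostComponent n (dwork p hB φ hφ b) = φ^[n] b := by
  rw [ghostComponent_eq_sum]
  exact dworkCoeff_spec p φ hφ b n

variable (k : Type*) [Field k] [CharP k p] [PerfectRing k p]

theorem frobenius_sub_pow_dvd (x : WittVector p k) :
    (p : WittVector p k) ∣ frobenius x - x ^ p := by
  rw [← Ideal.mem_span_singleton, mem_span_p_iff_coeff_zero_eq_zero]
  change constantCoeff (frobenius x - x ^ p) = 0
  rw [map_sub, map_pow, sub_eq_zero]
  exact coeff_frobenius_charP p x 0

/-- The Cartier homomorphism `Δ : W(k) → W(W(k))`: the Witt vector `Δ x` has ghost components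
`x, f(x), f(f(x)), …`. -/
def cartier : WittVector p k →+* WittVector p (WittVector p k) :=
  dwork p (fun x hx => eq_zero_of_p_mul_eq_zero x (by rw [mul_comm]; exact hx)) frobenius
    (frobenius_sub_pow_dvd p k)

theorem ghostComponent_cartier (n : ℕ) (x : WittVector p k) :
    ghostComponent n (cartier p k x) = frobenius^[n] x :=
  ghostComponent_dwork p _ _ _ n x

variable (R : Type*) [CommRing R] [Algebra (WittVector p k) R]

/-- The structure of a `W(k)`-algebra on `W(R)^⊕` for a `W(k)`-algebra `R`, by way of
`W(k) → W(W(k)) → W(R) → W(R)^⊕`. -/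
instance GradedWitt.algebra : Algebra (WittVector p k) (GradedWitt p R) :=
  ((GradedWitt.ofWitt p R).comp
    ((WittVector.map (algebraMap (WittVector p k) R)).comp (cartier p k))).toAlgebra

theorem GradedWitt.algebraMap_eq (x : WittVector p k) :
    algebraMap (WittVector p k) (GradedWitt p R) x =
      GradedWitt.ofWitt p R (WittVector.map (algebraMap (WittVector p k) R) (cartier p k x)) :=
  rfl

theorem GradedWitt.algebraMap_mem (x : WittVector p k) :
    algebraMap (WittVector p k) (GradedWitt p R) x ∈ GradedWitt.deg p R 0 :=
  ⟨_, rfl⟩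

/-- The piece of degree `n` of `W(R)^⊕`, as a `W(k)`-submodule. -/
def wittDeg (n : ℤ) : Submodule (WittVector p k) (GradedWitt p R) :=
  { GradedWitt.deg p R n with
    smul_mem' := fun c x hx => by
      have h := sumDeg_mul_mem (wittPiece p R) (GradedWitt.algebraMap_mem p k R c) hx
      rw [zero_add] at h
      rw [Algebra.smul_def]
      exact h }

theorem mem_wittDeg {n : ℤ} {x : GradedWitt p R} :
    x ∈ wittDeg p k R n ↔ x ∈ GradedWitt.deg p R n := Iff.rfl

instance wittDeg_gradedMonoid : SetLike.GradedMonoid (wittDeg p k R) where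
  one_mem := by
    have h := GradedWitt.algebraMap_mem p k R 1
    rw [map_one] at h
    exact h
  mul_mem _ _ _ _ hx hy := sumDeg_mul_mem (wittPiece p R) hx hy

/-- The inclusion of the piece of degree `n`. -/
def toWittDeg (n : ℤ) : wittPiece p R n →+ wittDeg p k R n :=
  (DirectSum.of (fun n => wittPiece p R n) n).codRestrict (wittDeg p k R n) fun x => ⟨x, rfl⟩

/-- The decomposition of an element of `W(R)^⊕` into its homogeneous components. -/
def decomposeWitt : (⨁ n, wittPiece p R n) →+ ⨁ n, wittDeg p k R n :=
  DirectSum.toAddMonoid fun n =>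
    (DirectSum.of (fun n => wittDeg p k R n) n).comp (toWittDeg p k R n)

theorem decomposeWitt_of (n : ℤ) (x : wittPiece p R n) :
    decomposeWitt p k R (DirectSum.of (fun n => wittPiece p R n) n x) =
      DirectSum.of (fun n => wittDeg p k R n) n (toWittDeg p k R n x) :=
  DirectSum.toAddMonoid_of (fun n =>
    (DirectSum.of (fun n => wittDeg p k R n) n).comp (toWittDeg p k R n)) n x

/-- The graded Witt ring `W(R)^⊕` is a graded `W(k)`-algebra. -/
instance wittDeg_gradedAlgebra : GradedAlgebra (wittDeg p k R) where
  toDecomposition := DirectSum.Decomposition.ofAddHom _ (decomposeWitt p k R)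
    (DirectSum.addHom_ext fun n x =>
      (congrArg (DirectSum.coeAddMonoidHom (wittDeg p k R)) (decomposeWitt_of p k R n x)).trans
        (DirectSum.coeAddMonoidHom_of (wittDeg p k R) n _))
    (DirectSum.addHom_ext fun n x => by
      obtain ⟨_, y, rfl⟩ := x
      exact (congrArg (decomposeWitt p k R)
        (DirectSum.coeAddMonoidHom_of (wittDeg p k R) n _)).trans (decomposeWitt_of p k R n y))

variable {R} {R' R'' : Type*} [CommRing R'] [Algebra (WittVector p k) R'] [CommRing R'']
  [Algebra (WittVector p k) R'']

theorem GradedWitt.map_mem {n : ℤ} (φ : R →+* R') {x : GradedWitt p R}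
    (hx : x ∈ wittDeg p k R n) : GradedWitt.map p φ x ∈ wittDeg p k R' n := by
  obtain ⟨y, rfl⟩ := hx
  exact ⟨_, (sumMap_of (wittPiece p R) (wittPiece p R') _ _ n y).symm⟩

theorem GradedWitt.map_ofWitt (φ : R →+* R') (x : WittVector p R) :
    GradedWitt.map p φ (GradedWitt.ofWitt p R x) = GradedWitt.ofWitt p R' (WittVector.map φ x) := by
  refine (sumMap_of (wittPiece p R) (wittPiece p R') _ _ 0 _).trans ?_
  refine congrArg (DirectSum.of (fun n => wittPiece p R' n) 0) (Subtype.ext ?_)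
  exact Prod.ext rfl (map_frobenius φ x)

variable {k} in
/-- The homomorphism of `W(k)`-algebras `W(R)^⊕ → W(R')^⊕` induced by a homomorphism of
`W(k)`-algebras `R → R'`. -/
def GradedWitt.mapAlg (φ : R →ₐ[WittVector p k] R') :
    GradedWitt p R →ₐ[WittVector p k] GradedWitt p R' :=
  { GradedWitt.map p (φ : R →+* R') with
    commutes' := fun x => by
      change GradedWitt.map p (φ : R →+* R') (GradedWitt.ofWitt p R _) = GradedWitt.ofWitt p R' _
      rw [GradedWitt.map_ofWitt]
      congr 1
      ext n
      rw [map_coeff]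
      change φ ((WittVector.map (algebraMap (WittVector p k) R) (cartier p k x)).coeff n) =
        (WittVector.map (algebraMap (WittVector p k) R') (cartier p k x)).coeff n
      rw [map_coeff, map_coeff]
      exact φ.commutes _ }

theorem GradedWitt.map_of (φ : R →+* R') (n : ℤ) (x : wittPiece p R n) :
    GradedWitt.map p φ (DirectSum.of (fun n => wittPiece p R n) n x) =
      DirectSum.of (fun n => wittPiece p R' n) n
        ⟨RingHom.prodMap (WittVector.map φ) (WittVector.map φ) x.1,
          prodMap_mem_wittPiece φ n x.1 x.2⟩ :=
  sumMap_of (wittPiece p R) (wittPiece p R') _ _ n x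

theorem GradedWitt.map_id (x : GradedWitt p R) : GradedWitt.map p (RingHom.id R) x = x := by
  have h : (GradedWitt.map p (RingHom.id R) : (⨁ n, wittPiece p R n) →+* ⨁ n, wittPiece p R n) =
      RingHom.id _ := by
    refine DirectSum.ringHom_ext fun n x => (GradedWitt.map_of p _ n x).trans ?_
    refine congrArg (DirectSum.of (fun n => wittPiece p R n) n) (Subtype.ext ?_)
    exact Prod.ext (WittVector.ext fun m => rfl) (WittVector.ext fun m => rfl)
  exact RingHom.congr_fun h x

theorem GradedWitt.map_comp (ψ : R' →+* R'') (φ : R →+* R') (x : GradedWitt p R) :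
    GradedWitt.map p (ψ.comp φ) x = GradedWitt.map p ψ (GradedWitt.map p φ x) := by
  have h : (GradedWitt.map p (ψ.comp φ) : (⨁ n, wittPiece p R n) →+* ⨁ n, wittPiece p R'' n) =
      RingHom.comp (GradedWitt.map p ψ :
        (⨁ n, wittPiece p R' n) →+* ⨁ n, wittPiece p R'' n) (GradedWitt.map p φ) := by
    refine DirectSum.ringHom_ext fun n x => (GradedWitt.map_of p _ n x).trans ?_
    refine Eq.trans ?_ (congrArg (GradedWitt.map p ψ) (GradedWitt.map_of p φ n x)).symm
    refine Eq.trans ?_ (GradedWitt.map_of p ψ n _).symm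
    refine congrArg (DirectSum.of (fun n => wittPiece p R'' n) n) (Subtype.ext ?_)
    exact Prod.ext (WittVector.ext fun m => rfl) (WittVector.ext fun m => rfl)
  exact RingHom.congr_fun h x

theorem GradedWitt.mapAlg_id :
    GradedWitt.mapAlg p (AlgHom.id (WittVector p k) R) = AlgHom.id _ _ :=
  AlgHom.ext fun x => GradedWitt.map_id p x

theorem GradedWitt.mapAlg_comp (ψ : R' →ₐ[WittVector p k] R'') (φ : R →ₐ[WittVector p k] R') :
    GradedWitt.mapAlg p (ψ.comp φ) = (GradedWitt.mapAlg p ψ).comp (GradedWitt.mapAlg p φ) :=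
  AlgHom.ext fun x => GradedWitt.map_comp p (ψ : R' →+* R'') (φ : R →+* R') x

/-- The structure of a `ℤ_p`-algebra on `W(k)`, by way of `ℤ_p = W(𝔽_p) → W(k)`. -/
instance wittAlgebra : Algebra ℤ_[p] (WittVector p k) :=
  ((WittVector.map (ZMod.castHom (dvd_refl p) k)).comp
    (WittVector.equiv p).symm.toRingHom).toAlgebra

end Cartier

/-! ### Points of an affine group scheme and the conjugation action of a cocharacter -/

section Points

open WithConv LaurentPolynomial

/-- The `B`-valued points of the affine group scheme `Spec K` over `W`. -/
def Points (W K B : Type*) [CommRing W] [CommRing K] [HopfAlgebra W K] [CommRing B]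
    [Algebra W B] : Type _ := WithConv (K →ₐ[W] B)

namespace Points

variable {W K B B' B'' : Type*} [CommRing W] [CommRing K] [HopfAlgebra W K] [CommRing B]
  [Algebra W B] [CommRing B'] [Algebra W B'] [CommRing B''] [Algebra W B'']

/-- The point given by an algebra homomorphism. -/
def mk (g : K →ₐ[W] B) : Points W K B := toConv g

/-- The algebra homomorphism that is given by a point. -/
def hom (g : Points W K B) : K →ₐ[W] B := ofConv g

theorem ext {g h : Points W K B} (H : g.hom = h.hom) : g = h := ofConv_injective H

instance : Monoid (Points W K B) := inferInstanceAs (Monoid (WithConv (K →ₐ[W] B)))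

theorem one_hom_apply (a : K) :
    (1 : Points W K B).hom a = algebraMap W B (Coalgebra.counit (R := W) a) := rfl

theorem mul_hom (g h : Points W K B) :
    (g * h).hom = (Algebra.TensorProduct.lift g.hom h.hom fun _ _ => .all ..).comp
      (Bialgebra.comulAlgHom W K) := by
  ext a
  exact AlgHom.convMul_apply (R := W) (A := B) (C := K) g h a

theorem mul_hom_apply (g h : Points W K B) (a : K) :
    (g * h).hom a = Algebra.TensorProduct.lift g.hom h.hom (fun _ _ => .all ..)
      (Coalgebra.comul (R := W) a) :=
  AlgHom.convMul_apply (R := W) (A := B) (C := K) g h a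

/-- The map on points given by a homomorphism of algebras. -/
def map (φ : B →ₐ[W] B') : Points W K B →* Points W K B' where
  toFun g := mk (φ.comp g.hom)
  map_one' := by
    refine ext (AlgHom.ext fun a => ?_)
    exact φ.commutes _
  map_mul' g h := by
    refine ext ?_
    change φ.comp (g * h).hom = (mk (φ.comp g.hom) * mk (φ.comp h.hom)).hom
    rw [mul_hom, mul_hom, ← AlgHom.comp_assoc]
    congr 1
    ext <;> simp [mk, hom]

theorem map_hom (φ : B →ₐ[W] B') (g : Points W K B) : (map φ g).hom = φ.comp g.hom := rfl

theorem map_hom_apply (φ : B →ₐ[W] B') (g : Points W K B) (a : K) :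
    (map φ g).hom a = φ (g.hom a) := rfl

/-- The group law on points: the product is given by the comultiplication, the inverse by the
antipode. -/
instance : Group (Points W K B) where
  inv g := mk (g.hom.comp (HopfAlgebra.antipodeAlgHom W K))
  inv_mul_cancel g := by
    refine ext (AlgHom.ext fun a => ?_)
    rw [mul_hom_apply, one_hom_apply, ← g.hom.commutes,
      ← HopfAlgebra.mul_antipode_rTensor_comul_apply]
    generalize Coalgebra.comul (R := W) a = x
    induction x with
    | zero => simp
    | tmul x y => simp [mk, hom]
    | add x y hx hy => simp only [map_add, hx, hy]

variable (μ : K →ₐc[W] W[T;T⁻¹])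

/-- The homomorphism `W[T;T⁻¹] → B` with `T ↦ u`, for a unit `u` of `B`. -/
def evalUnit (u : Bˣ) : W[T;T⁻¹] →ₐ[W] B :=
  { LaurentPolynomial.eval₂ (algebraMap W B) u with
    commutes' := fun w => by
      simp [← LaurentPolynomial.C_eq_algebraMap] }

theorem evalUnit_T (u : Bˣ) (n : ℤ) : evalUnit (W := W) u (T n) = ((u ^ n : Bˣ) : B) :=
  LaurentPolynomial.eval₂_T _ _ n

theorem algHom_ext_T {φ ψ : W[T;T⁻¹] →ₐ[W] B} (h : ∀ n : ℤ, φ (T n) = ψ (T n)) : φ = ψ := by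
  refine AlgHom.ext fun f => ?_
  induction f using LaurentPolynomial.induction_on' with
  | add f g hf hg => rw [map_add, map_add, hf, hg]
  | C_mul_T n a => rw [map_mul, map_mul, h, C_eq_algebraMap, φ.commutes, ψ.commutes]

/-- The value `μ(u)` of the cocharacter `μ` at `u ∈ 𝔾_m(B)`. -/
def cochar : Bˣ →* Points W K B where
  toFun u := mk ((evalUnit u).comp (μ : K →ₐ[W] W[T;T⁻¹]))
  map_one' := by
    refine ext ?_
    have h : evalUnit (W := W) (1 : Bˣ) = (1 : Points W W[T;T⁻¹] B).hom := by
      refine algHom_ext_T fun n => ?_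
      rw [one_hom_apply, evalUnit_T, one_zpow, LaurentPolynomial.counit_T, map_one, Units.val_one]
    refine AlgHom.ext fun a => ?_
    rw [one_hom_apply]
    change evalUnit (W := W) (1 : Bˣ) (μ a) = _
    rw [h, one_hom_apply]
    congr 1
    exact CoalgHomClass.counit_comp_apply μ a
  map_mul' u v := by
    refine ext ?_
    have h : mk (evalUnit (W := W) (u * v)) = mk (evalUnit u) * mk (evalUnit v) := by
      refine ext (algHom_ext_T fun n => ?_)
      rw [mul_hom_apply, LaurentPolynomial.comul_T, Algebra.TensorProduct.lift_tmul]
      change evalUnit (W := W) (u * v) (T n) = evalUnit (W := W) u (T n) * evalUnit (W := W) v (T n)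
      rw [evalUnit_T, evalUnit_T, evalUnit_T, mul_zpow, Units.val_mul]
    have h' := congrArg Points.hom h
    refine Eq.trans (congrArg (fun φ => AlgHom.comp φ (μ : K →ₐ[W] W[T;T⁻¹])) h') ?_
    exact AlgHom.convMul_comp_bialgHom_distrib (R := W) (A := B) _ _ μ

theorem map_cochar (φ : B →ₐ[W] B') (u : Bˣ) :
    map φ (cochar μ u) = cochar μ (Units.map (φ : B →* B') u) := by
  refine ext ?_
  change φ.comp ((evalUnit u).comp (μ : K →ₐ[W] W[T;T⁻¹])) =
    (evalUnit _).comp (μ : K →ₐ[W] W[T;T⁻¹])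
  rw [← AlgHom.comp_assoc]
  congr 1
  refine algHom_ext_T fun n => ?_
  rw [AlgHom.comp_apply, evalUnit_T, evalUnit_T, ← map_zpow]
  rfl

/-- The conjugate `μ(u)⁻¹ * g * μ(u)` of a point `g ∈ G(B)`, for `u ∈ 𝔾_m(B)`. -/
def conj (u : Bˣ) (g : Points W K B) : Points W K B := (cochar μ u)⁻¹ * g * cochar μ u

theorem map_conj (φ : B →ₐ[W] B') (u : Bˣ) (g : Points W K B) :
    map φ (conj μ u g) = conj μ (Units.map (φ : B →* B') u) (map φ g) := by
  simp only [conj, map_mul, map_inv, map_cochar]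

theorem conj_mul (u : Bˣ) (g h : Points W K B) : conj μ u (g * h) = conj μ u g * conj μ u h := by
  simp only [conj]; group

theorem conj_inv (u : Bˣ) (g : Points W K B) : conj μ u g⁻¹ = (conj μ u g)⁻¹ := by
  simp only [conj]; group

theorem conj_one (u : Bˣ) : conj μ u (1 : Points W K B) = 1 := by
  simp only [conj]; group

theorem conj_one_left (g : Points W K B) : conj μ 1 g = g := by
  simp only [conj, map_one]; group

theorem conj_conj (u v : Bˣ) (g : Points W K B) : conj μ u (conj μ v g) = conj μ (v * u) g := by
  simp only [conj, map_mul]; group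

end Points
end Points

/-! ### The grading on the coordinate ring and the display group -/

section DisplayGroup

open LaurentPolynomial

variable {W K B : Type*} [CommRing W] [CommRing K] [HopfAlgebra W K] [CommRing B] [Algebra W B]

variable (W B) in
/-- The inclusion of the constants, as a homomorphism of `W`-algebras. -/
def constHom : B →ₐ[W] B[T;T⁻¹] :=
  { (C : B →+* B[T;T⁻¹]) with
    commutes' := fun _ => (LaurentPolynomial.algebraMap_apply _).symm }

theorem constHom_apply (b : B) : constHom W B b = C b := rfl

variable (B) in
/-- The unit `T` of `B[T;T⁻¹]`. -/
def unitT : B[T;T⁻¹]ˣ where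
  val := T 1
  inv := T (-1)
  val_inv := by rw [← T_add, add_neg_cancel, T_zero]
  inv_val := by rw [← T_add, neg_add_cancel, T_zero]

theorem unitT_zpow (n : ℤ) : ((unitT B ^ n : B[T;T⁻¹]ˣ) : B[T;T⁻¹]) = T n := by
  have h : ∀ m : ℕ, ((unitT B ^ m : B[T;T⁻¹]ˣ) : B[T;T⁻¹]) = T m := fun m => by
    rw [Units.val_pow_eq_pow_val]
    change (T 1 : B[T;T⁻¹]) ^ m = _
    rw [T_pow, mul_one]
  rcases Int.eq_nat_or_neg n with ⟨m, rfl | rfl⟩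
  · rw [zpow_natCast, h]
  · rw [zpow_neg, zpow_natCast]
    refine Units.inv_eq_of_mul_eq_one_right ?_
    rw [h, ← T_add, add_neg_cancel, T_zero]

/-- The homomorphism `K[T;T⁻¹] → B` given by `g : K → B` and `T ↦ u`. -/
def evalHom (g : K →ₐ[W] B) (u : Bˣ) : K[T;T⁻¹] →ₐ[W] B :=
  { LaurentPolynomial.eval₂ (g : K →+* B) u with
    commutes' := fun w => by
      simp [LaurentPolynomial.algebraMap_apply] }

theorem evalHom_C_mul_T (g : K →ₐ[W] B) (u : Bˣ) (a : K) (n : ℤ) :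
    evalHom g u (C a * T n) = g a * ((u ^ n : Bˣ) : B) :=
  LaurentPolynomial.eval₂_C_mul_T _ _ _ _

theorem evalHom_comp_constHom (g : K →ₐ[W] B) (u : Bˣ) :
    (evalHom g u).comp (constHom W K) = g :=
  AlgHom.ext fun _ => LaurentPolynomial.eval₂_C _ _ _

theorem map_unitT (g : K →ₐ[W] B) (u : Bˣ) :
    Units.map (evalHom g u : K[T;T⁻¹] →* B) (unitT K) = u := by
  refine Units.ext ?_
  change evalHom g u (T 1) = u
  rw [← one_mul (T 1), ← map_one C, evalHom_C_mul_T, map_one, one_mul, zpow_one]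

variable (μ : K →ₐc[W] W[T;T⁻¹])

variable (W K) in
/-- The universal point of `G` over `K[T;T⁻¹]`, the coordinate ring of `G × 𝔾_m`. -/
def univPoint : Points W K K[T;T⁻¹] := Points.mk (constHom W K)

/-- The piece of degree `n` of the coordinate ring `K` of `G`, for the action `f ↦ λ · f` of `𝔾_m`
with `(λ · f)(g) = f(μ(λ)⁻¹ * g * μ(λ))`: it consists of all `f` with `λ · f = λ ^ n * f`, for the
universal `λ` and `g`. -/
def conjDeg (n : ℤ) : Submodule W K where
  carrier := {f | (Points.conj μ (unitT K) (univPoint W K)).hom f = C f * T n}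
  zero_mem' := by
    rw [Set.mem_ofPred_eq, map_zero, map_zero, zero_mul]
  add_mem' {f f'} hf hf' := by
    rw [Set.mem_ofPred_eq] at *
    rw [map_add, hf, hf', map_add, add_mul]
  smul_mem' w f hf := by
    rw [Set.mem_ofPred_eq] at *
    rw [map_smul, hf, ← smul_mul_assoc]
    congr 1
    exact (map_smul (constHom W K) w f).symm

theorem mem_conjDeg {n : ℤ} {f : K} :
    f ∈ conjDeg μ n ↔ (Points.conj μ (unitT K) (univPoint W K)).hom f = C f * T n := Iff.rfl

theorem map_conj_univPoint (u : Bˣ) (g : Points W K B) :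
    Points.map (evalHom g.hom u) (Points.conj μ (unitT K) (univPoint W K)) =
      Points.conj μ u g := by
  rw [Points.map_conj, map_unitT]
  congr 1
  exact Points.ext (evalHom_comp_constHom _ _)

/-- For `f` of degree `n` one has `f(μ(u)⁻¹ * g * μ(u)) = u ^ n * f(g)` for all `g ∈ G(B)` and
`u ∈ 𝔾_m(B)`. -/
theorem conj_hom_of_mem {n : ℤ} {f : K} (hf : f ∈ conjDeg μ n) (u : Bˣ) (g : Points W K B) :
    (Points.conj μ u g).hom f = g.hom f * ((u ^ n : Bˣ) : B) := by
  rw [← map_conj_univPoint, Points.map_hom_apply, (mem_conjDeg μ).1 hf, evalHom_C_mul_T]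

theorem coeff_C_mul_T (a : K) (m n : ℤ) :
    (C a * T m : K[T;T⁻¹]).coeff n = if m = n then a else 0 := by
  rw [← single_eq_C_mul_T]
  exact Finsupp.single_apply

theorem coeff_mem_conjDeg (f : K) (n : ℤ) :
    ((Points.conj μ (unitT K) (univPoint W K)).hom f).coeff n ∈ conjDeg μ n := by
  set c := Points.conj μ (unitT K) (univPoint W K) with hc
  let c' : K →ₐ[W] K[T;T⁻¹][T;T⁻¹] := (constHom W K[T;T⁻¹]).comp c.hom
  let d' : K →ₐ[W] K[T;T⁻¹][T;T⁻¹] := (constHom W K[T;T⁻¹]).comp (constHom W K)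
  let t : K[T;T⁻¹][T;T⁻¹]ˣ := Units.map (constHom W K[T;T⁻¹] : _ →* _) (unitT K)
  have h1 : ∀ F : K[T;T⁻¹], (evalHom c' (unitT _) F).coeff n = c.hom (F.coeff n) := by
    intro F
    induction F using LaurentPolynomial.induction_on' with
    | add F G hF hG => simp only [map_add, AddMonoidAlgebra.coeff_add, Finsupp.add_apply, hF, hG]
    | C_mul_T m a =>
      rw [evalHom_C_mul_T, unitT_zpow]
      change (C (c.hom a) * T m : K[T;T⁻¹][T;T⁻¹]).coeff n = _
      rw [coeff_C_mul_T, coeff_C_mul_T]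
      split_ifs <;> simp
  have h2 : ∀ F : K[T;T⁻¹], (evalHom d' (t * unitT _) F).coeff n = C (F.coeff n) * T n := by
    intro F
    induction F using LaurentPolynomial.induction_on' with
    | add F G hF hG =>
      simp only [map_add, AddMonoidAlgebra.coeff_add, Finsupp.add_apply, hF, hG, add_mul]
    | C_mul_T m a =>
      have hz : (t * unitT K[T;T⁻¹]) ^ m = t ^ m * unitT K[T;T⁻¹] ^ m :=
        (show Commute t (unitT K[T;T⁻¹]) from Units.ext (mul_comm _ _)).mul_zpow m
      have ht : t ^ m = Units.map (constHom W K[T;T⁻¹] : _ →* _) (unitT K ^ m) :=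
        (map_zpow _ _ _).symm
      rw [evalHom_C_mul_T, hz, Units.val_mul, unitT_zpow, ht]
      change (C (C a) * (C ((unitT K ^ m : K[T;T⁻¹]ˣ) : K[T;T⁻¹]) * T m) :
        K[T;T⁻¹][T;T⁻¹]).coeff n = _
      rw [← mul_assoc, ← map_mul, coeff_C_mul_T, coeff_C_mul_T, unitT_zpow]
      split_ifs with h
      · rw [h]
      · simp
  have h3 : Points.map (evalHom c' (unitT _)) c = Points.map (evalHom d' (t * unitT _)) c := by
    have e1 := map_conj_univPoint μ (unitT _) (Points.mk c')
    have e2 := map_conj_univPoint μ (t * unitT _) (Points.mk d')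
    refine e1.trans (Eq.trans ?_ e2.symm)
    have e3 : Points.mk c' = Points.map (constHom W K[T;T⁻¹]) c := rfl
    rw [e3, hc, Points.map_conj, Points.conj_conj]
    rfl
  rw [mem_conjDeg, ← hc, ← h1, ← h2]
  exact congrArg (fun F => AddMonoidAlgebra.coeff F n) (congrArg (fun q => Points.hom q f) h3)

theorem iSup_conjDeg : ⨆ n, conjDeg μ n = ⊤ := by
  refine eq_top_iff.2 fun f _ => ?_
  have h : ∀ (N : Submodule W K) (F : K[T;T⁻¹]), (∀ n, F.coeff n ∈ N) →
      evalHom (AlgHom.id W K) 1 F ∈ N := by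
    intro N F hF
    have : evalHom (AlgHom.id W K) 1 F = F.coeff.sum fun _ a => a := by
      clear hF
      induction F using LaurentPolynomial.induction_on' with
      | add F G hF hG =>
        rw [map_add, hF, hG, AddMonoidAlgebra.coeff_add, Finsupp.sum_add_index'] <;> simp
      | C_mul_T m a =>
        rw [evalHom_C_mul_T, ← single_eq_C_mul_T, one_zpow, Units.val_one, mul_one]
        exact (Finsupp.sum_single_index (h := fun (_ : ℤ) (a : K) => a) rfl).symm
    rw [this]
    exact Submodule.sum_mem _ fun n _ => hF n
  have h' := h (⨆ n, conjDeg μ n) _ fun n => Submodule.mem_iSup_of_mem n (coeff_mem_conjDeg μ f n)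
  rw [← Points.map_hom_apply] at h'
  have e := map_conj_univPoint μ 1 (Points.mk (AlgHom.id W K))
  rw [Points.conj_one_left] at e
  have e' := congrArg (fun q => Points.hom q f) e
  rw [show f = (Points.mk (AlgHom.id W K)).hom f from rfl, ← e']
  exact h'

variable {S : Type*} [CommRing S] [Algebra W S] (𝒮 : ℤ → Submodule W S) [GradedAlgebra 𝒮]

/-- The coaction `S → S[T;T⁻¹]` that corresponds to the grading of `S`. -/
def gradCoact : S →ₐ[W] S[T;T⁻¹] :=
  (DirectSum.toAlgebra W (fun n => 𝒮 n)
    (fun n => (LinearMap.mulRight W (T n : S[T;T⁻¹])) ∘ₗ (constHom W S).toLinearMap ∘ₗ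
      (𝒮 n).subtype)
    (by
      change (C (1 : S) * T 0 : S[T;T⁻¹]) = 1
      rw [map_one, one_mul, T_zero])
    (fun {i j} x y => by
      change (C ((x : S) * (y : S)) * T (i + j) : S[T;T⁻¹]) = C (x : S) * T i * (C (y : S) * T j)
      rw [map_mul, T_add, mul_mul_mul_comm])).comp
    (DirectSum.decomposeAlgEquiv 𝒮 : S →ₐ[W] ⨁ n, 𝒮 n)

theorem gradCoact_of_mem {n : ℤ} {s : S} (hs : s ∈ 𝒮 n) : gradCoact 𝒮 s = C s * T n := by
  have h : (DirectSum.decomposeAlgEquiv 𝒮 : S →ₐ[W] ⨁ n, 𝒮 n) s =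
      DirectSum.of (fun n => 𝒮 n) n ⟨s, hs⟩ := DirectSum.decompose_of_mem 𝒮 hs
  rw [gradCoact, AlgHom.comp_apply, h]
  exact DirectSum.toAddMonoid_of (fun n => ((LinearMap.mulRight W (T n : S[T;T⁻¹])) ∘ₗ
    (constHom W S).toLinearMap ∘ₗ (𝒮 n).subtype).toAddMonoidHom) n ⟨s, hs⟩

theorem mem_of_gradCoact {n : ℤ} {s : S} (hs : gradCoact 𝒮 s = C s * T n) : s ∈ 𝒮 n := by
  have h : ∀ s, (gradCoact 𝒮 s).coeff n ∈ 𝒮 n := by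
    intro s
    induction s using DirectSum.Decomposition.inductionOn 𝒮 with
    | zero => rw [map_zero]; exact zero_mem _
    | homogeneous s =>
      rw [gradCoact_of_mem 𝒮 s.2, coeff_C_mul_T]
      split_ifs with h
      · exact h ▸ s.2
      · exact zero_mem _
    | add s s' hs hs' =>
      rw [map_add]
      exact add_mem hs hs'
  have h' := h s
  rwa [hs, coeff_C_mul_T, if_pos rfl] at h'

theorem preserves_iff (h : Points W K S) :
    (∀ n, ∀ f ∈ conjDeg μ n, h.hom f ∈ 𝒮 n) ↔
      Points.map (gradCoact 𝒮) h = Points.conj μ (unitT S) (Points.map (constHom W S) h) := by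
  constructor
  · intro H
    refine Points.ext (AlgHom.ext fun f => ?_)
    have hf : f ∈ ⨆ n, conjDeg μ n := by rw [iSup_conjDeg]; trivial
    induction hf using Submodule.iSup_induction' with
    | mem n f hf =>
      rw [conj_hom_of_mem μ hf, Points.map_hom_apply, Points.map_hom_apply,
        gradCoact_of_mem 𝒮 (H n f hf), unitT_zpow, constHom_apply]
    | zero => rw [map_zero, map_zero]
    | add f g _ _ hf hg => rw [map_add, map_add, hf, hg]
  · intro H n f hf
    refine mem_of_gradCoact 𝒮 ?_
    rw [← Points.map_hom_apply, H, conj_hom_of_mem μ hf, unitT_zpow]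
    rfl

/-- The group `G(S)_μ` for a `ℤ`-graded `W`-algebra `S`: all points `h : K → S` that preserve the
gradings. -/
def gradedPoints : Subgroup (Points W K S) where
  carrier := {h | ∀ n, ∀ f ∈ conjDeg μ n, h.hom f ∈ 𝒮 n}
  one_mem' := by
    rw [Set.mem_ofPred_eq, preserves_iff, map_one, map_one, Points.conj_one]
  mul_mem' {g h} hg hh := by
    rw [Set.mem_ofPred_eq, preserves_iff] at *
    rw [map_mul, map_mul, Points.conj_mul, hg, hh]
  inv_mem' {h} hh := by
    rw [Set.mem_ofPred_eq, preserves_iff] at *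
    rw [map_inv, map_inv, Points.conj_inv, hh]

end DisplayGroup

/-! ### Base change of endomorphisms along a homomorphism of algebras -/

section BaseChangeEnd

variable {W S S' S'' M N : Type*} [CommRing W] [CommRing S] [Algebra W S] [CommRing S']
  [Algebra W S'] [CommRing S''] [Algebra W S''] [AddCommGroup M] [Module W M]
  [AddCommGroup N] [Module W N]

variable (M) in
/-- The map `S ⊗ M → S' ⊗ M` induced by `φ : S → S'`. -/
def transfer (φ : S →ₐ[W] S') : S ⊗[W] M →ₗ[W] S' ⊗[W] M := φ.toLinearMap.rTensor M

theorem transfer_tmul (φ : S →ₐ[W] S') (s : S) (m : M) :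
    transfer M φ (s ⊗ₜ m) = φ s ⊗ₜ m := rfl

theorem transfer_smul (φ : S →ₐ[W] S') (s : S) (x : S ⊗[W] M) :
    transfer M φ (s • x) = φ s • transfer M φ x := by
  induction x with
  | zero => simp
  | tmul t m => simp [TensorProduct.smul_tmul', transfer_tmul]
  | add x y hx hy => simp only [smul_add, map_add, hx, hy]

theorem transfer_comp (φ : S →ₐ[W] S') (ψ : S' →ₐ[W] S'') (x : S ⊗[W] M) :
    transfer M (ψ.comp φ) x = transfer M ψ (transfer M φ x) := by
  induction x with
  | zero => simp
  | tmul t m => rfl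
  | add x y hx hy => simp only [map_add, hx, hy]

theorem transfer_id (x : S ⊗[W] M) : transfer M (AlgHom.id W S) x = x := by
  induction x with
  | zero => simp
  | tmul t m => rfl
  | add x y hx hy => simp only [map_add, hx, hy]

/-- The base change `S' ⊗ M → S' ⊗ N` along `φ : S → S'` of an `S`-linear map `S ⊗ M → S ⊗ N`. -/
def baseChangeAlong (φ : S →ₐ[W] S') (f : S ⊗[W] M →ₗ[S] S ⊗[W] N) :
    S' ⊗[W] M →ₗ[S'] S' ⊗[W] N :=
  LinearMap.liftBaseChange S'
    (transfer N φ ∘ₗ f.restrictScalars W ∘ₗ TensorProduct.mk W S M 1)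

theorem baseChangeAlong_tmul (φ : S →ₐ[W] S') (f : S ⊗[W] M →ₗ[S] S ⊗[W] N) (s : S') (m : M) :
    baseChangeAlong φ f (s ⊗ₜ m) = s • transfer N φ (f (1 ⊗ₜ m)) := rfl

theorem baseChangeAlong_transfer (φ : S →ₐ[W] S') (f : S ⊗[W] M →ₗ[S] S ⊗[W] N)
    (x : S ⊗[W] M) : baseChangeAlong φ f (transfer M φ x) = transfer N φ (f x) := by
  induction x with
  | zero => simp
  | tmul s m =>
    rw [transfer_tmul, baseChangeAlong_tmul, ← transfer_smul, ← map_smul,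
      TensorProduct.smul_tmul', smul_eq_mul, mul_one]
  | add x y hx hy => simp only [map_add, hx, hy]

theorem ext_transfer (φ : S →ₐ[W] S') {P : Type*} [AddCommGroup P] [Module S' P]
    {f g : S' ⊗[W] M →ₗ[S'] P} (h : ∀ x : S ⊗[W] M, f (transfer M φ x) = g (transfer M φ x))
    (x : S' ⊗[W] M) : f x = g x := by
  induction x with
  | zero => simp
  | tmul s m =>
    have h1 := h (1 ⊗ₜ m)
    rw [transfer_tmul, map_one] at h1
    rw [← mul_one s, ← smul_eq_mul, ← TensorProduct.smul_tmul', map_smul, map_smul, h1]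
  | add x y hx hy => simp only [map_add, hx, hy]

theorem baseChangeAlong_id (φ : S →ₐ[W] S') :
    baseChangeAlong φ (LinearMap.id : S ⊗[W] M →ₗ[S] S ⊗[W] M) = LinearMap.id :=
  LinearMap.ext <| ext_transfer φ fun x => baseChangeAlong_transfer φ _ x

theorem baseChangeAlong_comp {P : Type*} [AddCommGroup P] [Module W P] (φ : S →ₐ[W] S')
    (g : S ⊗[W] N →ₗ[S] S ⊗[W] P) (f : S ⊗[W] M →ₗ[S] S ⊗[W] N) :
    baseChangeAlong φ (g ∘ₗ f) = baseChangeAlong φ g ∘ₗ baseChangeAlong φ f :=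
  LinearMap.ext <| ext_transfer φ fun x => by
    rw [baseChangeAlong_transfer, LinearMap.comp_apply, LinearMap.comp_apply,
      baseChangeAlong_transfer, baseChangeAlong_transfer]

/-- The base change along `φ : S → S'` of an `S`-linear automorphism of `S ⊗ M`. -/
def equivAlong (φ : S →ₐ[W] S') : (S ⊗[W] M ≃ₗ[S] S ⊗[W] M) →* (S' ⊗[W] M ≃ₗ[S'] S' ⊗[W] M) where
  toFun f := LinearEquiv.ofLinearMap (baseChangeAlong φ f.toLinearMap)
    (baseChangeAlong φ f.symm.toLinearMap)
    (by rw [← baseChangeAlong_comp, LinearEquiv.comp_symm, baseChangeAlong_id])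
    (by rw [← baseChangeAlong_comp, LinearEquiv.symm_comp, baseChangeAlong_id])
  map_one' := LinearEquiv.toLinearMap_injective (baseChangeAlong_id φ)
  map_mul' f g := LinearEquiv.toLinearMap_injective (baseChangeAlong_comp φ f.toLinearMap g.toLinearMap)

theorem equivAlong_transfer (φ : S →ₐ[W] S') (f : S ⊗[W] M ≃ₗ[S] S ⊗[W] M) (x : S ⊗[W] M) :
    equivAlong φ f (transfer M φ x) = transfer M φ (f x) :=
  baseChangeAlong_transfer φ f.toLinearMap x

theorem equivAlong_id (f : S ⊗[W] M ≃ₗ[S] S ⊗[W] M) : equivAlong (AlgHom.id W S) f = f := by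
  refine LinearEquiv.ext fun x => ?_
  have h := equivAlong_transfer (AlgHom.id W S) f x
  rwa [transfer_id, transfer_id] at h

theorem equivAlong_comp (ψ : S' →ₐ[W] S'') (φ : S →ₐ[W] S') (f : S ⊗[W] M ≃ₗ[S] S ⊗[W] M) :
    equivAlong (ψ.comp φ) f = equivAlong ψ (equivAlong φ f) := by
  refine LinearEquiv.ext fun x => ext_transfer (ψ.comp φ)
    (f := (equivAlong (ψ.comp φ) f).toLinearMap)
    (g := (equivAlong ψ (equivAlong φ f)).toLinearMap) (fun x => ?_) x
  refine (equivAlong_transfer (ψ.comp φ) f x).trans ?_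
  rw [transfer_comp, transfer_comp, ← equivAlong_transfer φ, ← equivAlong_transfer ψ]
  rfl

end BaseChangeEnd

/-! ### Representations on finite free modules -/

section Representations

universe u v

/-- A representation of the affine group scheme `G = Spec H` over `O` on a finite free `O`-module,
that is, a comodule for the Hopf algebra `H` whose underlying `O`-module is finite and free. -/
structure FreeRep (O : Type u) (H : Type v) [CommRing O] [CommRing H] [HopfAlgebra O H] where
  /-- The underlying module. -/
  carrier : Type u
  [addCommGroup : AddCommGroup carrier]
  [module : Module O carrier]
  [free : Module.Free O carrier]
  [finite : Module.Finite O carrier]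
  /-- The coaction. -/
  coact : carrier →ₗ[O] carrier ⊗[O] H
  coact_assoc : (TensorProduct.assoc O carrier H H).toLinearMap ∘ₗ coact.rTensor H ∘ₗ coact =
    (Coalgebra.comul (R := O) (A := H)).lTensor carrier ∘ₗ coact
  coact_counit : (TensorProduct.rid O carrier).toLinearMap ∘ₗ
    (Coalgebra.counit (R := O) (A := H)).lTensor carrier ∘ₗ coact = LinearMap.id

attribute [instance] FreeRep.addCommGroup FreeRep.module FreeRep.free FreeRep.finite

namespace FreeRep

variable {O : Type u} {H : Type v} [CommRing O] [CommRing H] [HopfAlgebra O H]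

/-- Morphisms of representations are the linear maps that commute with the coactions. -/
def IsHom (V U : FreeRep O H) (f : V.carrier →ₗ[O] U.carrier) : Prop :=
  f.rTensor H ∘ₗ V.coact = U.coact ∘ₗ f

variable (O H) in
/-- The trivial representation on `O`. -/
def unit : FreeRep O H where
  carrier := O
  coact := (TensorProduct.mk O O H).flip 1
  coact_assoc := by
    ext
    simp [Algebra.TensorProduct.one_def]
  coact_counit := by
    ext
    simp

section Mul

variable {V U A B : Type*} [AddCommGroup V] [Module O V] [AddCommGroup U] [Module O U]
  [CommRing A] [Algebra O A] [CommRing B] [Algebra O B]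

variable (O V U A) in
/-- The map `(V ⊗ A) ⊗ (U ⊗ A) → (V ⊗ U) ⊗ A` with `(v ⊗ a) ⊗ (u ⊗ b) ↦ (v ⊗ u) ⊗ a * b`. -/
def mulCoact : (V ⊗[O] A) ⊗[O] (U ⊗[O] A) →ₗ[O] (V ⊗[O] U) ⊗[O] A :=
  (LinearMap.mul' O A).lTensor (V ⊗[O] U) ∘ₗ
    (TensorProduct.tensorTensorTensorComm O V A U A).toLinearMap

theorem mulCoact_tmul (v : V) (a : A) (u : U) (b : A) :
    mulCoact O V U A ((v ⊗ₜ a) ⊗ₜ (u ⊗ₜ b)) = (v ⊗ₜ u) ⊗ₜ (a * b) := rfl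

theorem lTensor_mulCoact (φ : A →ₐ[O] B) (x : V ⊗[O] A) (y : U ⊗[O] A) :
    φ.toLinearMap.lTensor (V ⊗[O] U) (mulCoact O V U A (x ⊗ₜ y)) =
      mulCoact O V U B (φ.toLinearMap.lTensor V x ⊗ₜ φ.toLinearMap.lTensor U y) := by
  induction x with
  | zero => simp
  | add x x' hx hx' => simp only [TensorProduct.add_tmul, map_add, hx, hx']
  | tmul v a =>
    induction y with
    | zero => simp
    | add y y' hy hy' => simp only [TensorProduct.tmul_add, map_add, hy, hy']
    | tmul u b => simp [mulCoact_tmul]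

theorem assoc_mulCoact (x : V ⊗[O] A) (y : U ⊗[O] A) (a b : A) :
    TensorProduct.assoc O (V ⊗[O] U) A A (mulCoact O V U A (x ⊗ₜ y) ⊗ₜ (a * b)) =
      mulCoact O V U (A ⊗[O] A)
        (TensorProduct.assoc O V A A (x ⊗ₜ a) ⊗ₜ TensorProduct.assoc O U A A (y ⊗ₜ b)) := by
  induction x with
  | zero => simp
  | add x x' hx hx' => simp only [TensorProduct.add_tmul, map_add, hx, hx']
  | tmul v a' =>
    induction y with
    | zero => simp
    | add y y' hy hy' => simp only [TensorProduct.add_tmul, TensorProduct.tmul_add, map_add, hy, hy']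
    | tmul u b' => simp [mulCoact_tmul]

theorem assoc_rTensor_mulCoact (ρ : V →ₗ[O] V ⊗[O] A) (π : U →ₗ[O] U ⊗[O] A) (x : V ⊗[O] A)
    (y : U ⊗[O] A) :
    TensorProduct.assoc O (V ⊗[O] U) A A
        ((mulCoact O V U A ∘ₗ TensorProduct.map ρ π).rTensor A (mulCoact O V U A (x ⊗ₜ y))) =
      mulCoact O V U (A ⊗[O] A) (TensorProduct.assoc O V A A (ρ.rTensor A x) ⊗ₜ
        TensorProduct.assoc O U A A (π.rTensor A y)) := by
  induction x with
  | zero => simp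
  | add x x' hx hx' => simp only [TensorProduct.add_tmul, map_add, hx, hx']
  | tmul v a =>
    induction y with
    | zero => simp
    | add y y' hy hy' => simp only [TensorProduct.tmul_add, map_add, hy, hy']
    | tmul u b =>
      rw [mulCoact_tmul, LinearMap.rTensor_tmul, LinearMap.rTensor_tmul, LinearMap.rTensor_tmul,
        LinearMap.comp_apply, TensorProduct.map_tmul, assoc_mulCoact]

end Mul

/-- The tensor product of two representations. -/
def tensor (V U : FreeRep O H) : FreeRep O H where
  carrier := V.carrier ⊗[O] U.carrier
  coact := mulCoact O V.carrier U.carrier H ∘ₗ TensorProduct.map V.coact U.coact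
  coact_assoc := by
    refine TensorProduct.ext' fun v u => ?_
    have hV := LinearMap.congr_fun V.coact_assoc v
    have hU := LinearMap.congr_fun U.coact_assoc u
    have h := lTensor_mulCoact (Bialgebra.comulAlgHom O H) (V.coact v) (U.coact u)
    have h' := assoc_rTensor_mulCoact V.coact U.coact (V.coact v) (U.coact u)
    exact h'.trans ((congrArg₂ (fun x y => mulCoact O V.carrier U.carrier (H ⊗[O] H) (x ⊗ₜ y))
      hV hU).trans h.symm)
  coact_counit := by
    refine TensorProduct.ext' fun v u => ?_
    have hV := LinearMap.congr_fun V.coact_counit v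
    have hU := LinearMap.congr_fun U.coact_counit u
    have h := lTensor_mulCoact (Bialgebra.counitAlgHom O H) (V.coact v) (U.coact u)
    have h' : ∀ (x : V.carrier ⊗[O] O) (y : U.carrier ⊗[O] O),
        TensorProduct.rid O (V.carrier ⊗[O] U.carrier) (mulCoact O V.carrier U.carrier O (x ⊗ₜ y)) =
          TensorProduct.rid O V.carrier x ⊗ₜ TensorProduct.rid O U.carrier y := by
      intro x y
      obtain ⟨v, rfl⟩ := (TensorProduct.rid O V.carrier).symm.surjective x
      obtain ⟨u, rfl⟩ := (TensorProduct.rid O U.carrier).symm.surjective y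
      simp [mulCoact_tmul]
    exact (congrArg (TensorProduct.rid O (V.carrier ⊗[O] U.carrier)) h).trans
      ((h' _ _).trans (congrArg₂ (fun x y => x ⊗ₜ y) hV hU))

variable (W : Type*) [CommRing W] [Algebra O W]

/-- The base change `V_W = W ⊗ V`. -/
abbrev Base (V : FreeRep O H) : Type _ := W ⊗[O] V.carrier

/-- The coaction of `W ⊗ H` on `V_W`. -/
def baseCoact (V : FreeRep O H) : V.Base W →ₗ[W] V.Base W ⊗[W] (W ⊗[O] H) :=
  (TensorProduct.AlgebraTensorModule.distribBaseChange O W V.carrier H).toLinearMap ∘ₗ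
    V.coact.baseChange W

variable {W}

/-- The action `ρ(h)` of a point `h ∈ G(B)` on `B ⊗ V_W`. -/
def act {B : Type*} [CommRing B] [Algebra W B] (V : FreeRep O H) (h : Points W (W ⊗[O] H) B) :
    B ⊗[W] V.Base W →ₗ[B] B ⊗[W] V.Base W :=
  LinearMap.liftBaseChange B ((TensorProduct.comm W (V.Base W) B).toLinearMap ∘ₗ
    h.hom.toLinearMap.lTensor (V.Base W) ∘ₗ V.baseCoact W)

open LaurentPolynomial

variable (μ : (W ⊗[O] H) →ₐc[W] W[T;T⁻¹])

/-- The piece of weight `i` of `V_W`: it consists of all `v` with `ρ(μ(z)) v = z ^ i v` for the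
universal `z`. -/
def weight (V : FreeRep O H) (i : ℤ) : Submodule W (V.Base W) :=
  LinearMap.eqLocus
    ((V.act (Points.cochar μ (unitT W))).restrictScalars W ∘ₗ
      TensorProduct.mk W W[T;T⁻¹] (V.Base W) 1)
    (TensorProduct.mk W W[T;T⁻¹] (V.Base W) (T i))

theorem mem_weight (V : FreeRep O H) (i : ℤ) (v : V.Base W) :
    v ∈ V.weight μ i ↔ V.act (Points.cochar μ (unitT W)) (1 ⊗ₜ v) = (T i : W[T;T⁻¹]) ⊗ₜ v :=
  Iff.rfl

variable {S : Type*} [CommRing S] [Algebra W S] (𝒮 : ℤ → Submodule W S)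

variable (W S) in
/-- The canonical graded fiber functor on objects: the `S`-module `S ⊗ V_W`. -/
abbrev Canon (V : FreeRep O H) : Type _ := S ⊗[W] V.Base W

/-- The piece of degree `l` of `S ⊗ V_W`: it is generated by the `s ⊗ v` with `s` homogeneous of
degree `l - i` and `v` of weight `i`. -/
def canonDeg (V : FreeRep O H) (l : ℤ) : Submodule W (V.Canon W S) :=
  Submodule.span W {x | ∃ i, ∃ s ∈ 𝒮 (l - i), ∃ v ∈ V.weight μ i, x = s ⊗ₜ v}

variable (W S) in
/-- The canonical graded fiber functor on morphisms. -/
def canonMap {V U : FreeRep O H} (f : V.carrier →ₗ[O] U.carrier) :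
    V.Canon W S →ₗ[S] U.Canon W S :=
  (f.baseChange W).baseChange S

variable (W) in
/-- The identification `V_W ⊗ U_W ≃ (V ⊗ U)_W`. -/
def baseTensor (V U : FreeRep O H) : V.Base W ⊗[W] U.Base W ≃ₗ[W] (V.tensor U).Base W :=
  (TensorProduct.AlgebraTensorModule.distribBaseChange O W V.carrier U.carrier).symm

theorem baseTensor_tmul (V U : FreeRep O H) (w w' : W) (v : V.carrier) (u : U.carrier) :
    baseTensor W V U ((w ⊗ₜ v) ⊗ₜ (w' ⊗ₜ u)) = (w * w') ⊗ₜ (v ⊗ₜ u : V.carrier ⊗[O] U.carrier) :=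
  TensorProduct.AlgebraTensorModule.distribBaseChange_symm_tmul _ _ _ _ _ _

variable (W S) in
/-- The tensor structure `(S ⊗ V_W) ⊗ (S ⊗ U_W) ≃ S ⊗ (V ⊗ U)_W` of the canonical graded fiber
functor. -/
def canonTensor (V U : FreeRep O H) :
    V.Canon W S ⊗[S] U.Canon W S ≃ₗ[S] (V.tensor U).Canon W S :=
  (TensorProduct.AlgebraTensorModule.distribBaseChange W S (V.Base W) (U.Base W)).symm ≪≫ₗ
    TensorProduct.AlgebraTensorModule.congr (LinearEquiv.refl S S) (baseTensor W V U)

theorem canonTensor_tmul (V U : FreeRep O H) (s s' : S) (v : V.Base W) (u : U.Base W) :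
    canonTensor W S V U ((s ⊗ₜ v) ⊗ₜ (s' ⊗ₜ u)) = (s * s') ⊗ₜ baseTensor W V U (v ⊗ₜ u) := by
  rw [canonTensor, LinearEquiv.trans_apply,
    TensorProduct.AlgebraTensorModule.distribBaseChange_symm_tmul]
  rfl

end FreeRep

end Representations

/-! ### Tensor automorphisms of the canonical graded fiber functor -/

section TensorAut

universe u v

open LaurentPolynomial

variable {O : Type u} {H : Type v} [CommRing O] [CommRing H] [HopfAlgebra O H]
  {W : Type*} [CommRing W] [Algebra O W] (μ : (W ⊗[O] H) →ₐc[W] W[T;T⁻¹])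
  {S S' : Type*} [CommRing S] [Algebra W S] [CommRing S'] [Algebra W S']
  (𝒮 : ℤ → Submodule W S) (𝒮' : ℤ → Submodule W S')

/-- The property of a family of `S`-linear automorphisms of the modules `S ⊗ V_W` to be an
automorphism of the tensor functor `V ↦ S ⊗ V_W` with values in graded `S`-modules. -/
structure IsTensorAut (lam : ∀ V : FreeRep O H, V.Canon W S ≃ₗ[S] V.Canon W S) : Prop where
  /-- Every component is an automorphism of graded modules. -/
  graded : ∀ (V : FreeRep O H) (l : ℤ) (x : V.Canon W S),
    lam V x ∈ V.canonDeg μ 𝒮 l ↔ x ∈ V.canonDeg μ 𝒮 l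
  /-- The family is natural. -/
  natural : ∀ (V U : FreeRep O H) (f : V.carrier →ₗ[O] U.carrier), FreeRep.IsHom V U f →
    ∀ x : V.Canon W S, lam U (FreeRep.canonMap W S f x) = FreeRep.canonMap W S f (lam V x)
  /-- The family is compatible with tensor products. -/
  tensor : ∀ (V U : FreeRep O H) (x : V.Canon W S) (y : U.Canon W S),
    lam (V.tensor U) (FreeRep.canonTensor W S V U (x ⊗ₜ y)) =
      FreeRep.canonTensor W S V U (lam V x ⊗ₜ lam U y)
  /-- The family is the identity on the unit object. -/
  unit : ∀ x : (FreeRep.unit O H).Canon W S, lam (FreeRep.unit O H) x = x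

/-- The group of tensor automorphisms of the canonical graded fiber functor `V ↦ S ⊗ V_W`. -/
def tensorAut : Subgroup (∀ V : FreeRep O H, V.Canon W S ≃ₗ[S] V.Canon W S) where
  carrier := {lam | IsTensorAut μ 𝒮 lam}
  one_mem' :=
    { graded := fun _ _ _ => Iff.rfl
      natural := fun _ _ _ _ _ => rfl
      tensor := fun _ _ _ _ => rfl
      unit := fun _ => rfl }
  mul_mem' {lam κ} hl hk :=
    { graded := fun V l x => (hl.graded V l (κ V x)).trans (hk.graded V l x)
      natural := fun V U f hf x =>
        (congrArg (lam U) (hk.natural V U f hf x)).trans (hl.natural V U f hf (κ V x))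
      tensor := fun V U x y =>
        (congrArg (lam (V.tensor U)) (hk.tensor V U x y)).trans (hl.tensor V U (κ V x) (κ U y))
      unit := fun x => (congrArg (lam _) (hk.unit x)).trans (hl.unit x) }
  inv_mem' {lam} hl :=
    { graded := fun V l x => by
        have h := hl.graded V l ((lam V).symm x)
        rw [LinearEquiv.apply_symm_apply] at h
        exact h.symm
      natural := fun V U f hf x => by
        refine (LinearEquiv.symm_apply_eq (lam U)).2 ?_
        have h := hl.natural V U f hf ((lam V).symm x)
        rw [LinearEquiv.apply_symm_apply] at h
        exact h.symm
      tensor := fun V U x y => by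
        refine (LinearEquiv.symm_apply_eq (lam (V.tensor U))).2 ?_
        have h := hl.tensor V U ((lam V).symm x) ((lam U).symm y)
        rw [LinearEquiv.apply_symm_apply, LinearEquiv.apply_symm_apply] at h
        exact h.symm
      unit := fun x => (LinearEquiv.symm_apply_eq (lam _)).2 (hl.unit x).symm }

variable {𝒮 𝒮'} (φ : S →ₐ[W] S')

theorem transfer_mem (hφ : ∀ n, ∀ s ∈ 𝒮 n, φ s ∈ 𝒮' n) 
    (V : FreeRep O H) {l : ℤ} {x : V.Canon W S} (hx : x ∈ V.canonDeg μ 𝒮 l) :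
    transfer (V.Base W) φ x ∈ V.canonDeg μ 𝒮' l := by
  induction hx using Submodule.span_induction with
  | mem x hx =>
    obtain ⟨i, s, hs, v, hv, rfl⟩ := hx
    exact Submodule.subset_span ⟨i, φ s, hφ _ s hs, v, hv, rfl⟩
  | zero => rw [map_zero]; exact zero_mem _
  | add x y _ _ hx hy => rw [map_add]; exact add_mem hx hy
  | smul w x _ hx => rw [map_smul]; exact Submodule.smul_mem _ _ hx

theorem smul_mem_canonDeg [SetLike.GradedMonoid 𝒮] (V : FreeRep O H) {j l : ℤ} {s : S}
    (hs : s ∈ 𝒮 j) {x : V.Canon W S} (hx : x ∈ V.canonDeg μ 𝒮 l) :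
    s • x ∈ V.canonDeg μ 𝒮 (j + l) := by
  induction hx using Submodule.span_induction with
  | mem x hx =>
    obtain ⟨i, s', hs', v, hv, rfl⟩ := hx
    refine Submodule.subset_span ⟨i, s * s', ?_, v, hv, rfl⟩
    rw [add_sub_assoc]
    exact SetLike.mul_mem_graded hs hs'
  | zero => rw [smul_zero]; exact zero_mem _
  | add x y _ _ hx hy => rw [smul_add]; exact add_mem hx hy
  | smul w x _ hx => rw [smul_comm]; exact Submodule.smul_mem _ _ hx

theorem equivAlong_mem [SetLike.GradedMonoid 𝒮] [SetLike.GradedMonoid 𝒮']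
    (hφ : ∀ n, ∀ s ∈ 𝒮 n, φ s ∈ 𝒮' n) (V : FreeRep O H)
    (f : V.Canon W S ≃ₗ[S] V.Canon W S)
    (hf : ∀ l, ∀ x ∈ V.canonDeg μ 𝒮 l, f x ∈ V.canonDeg μ 𝒮 l) {l : ℤ} {x : V.Canon W S'}
    (hx : x ∈ V.canonDeg μ 𝒮' l) : equivAlong φ f x ∈ V.canonDeg μ 𝒮' l := by
  induction hx using Submodule.span_induction with
  | mem x hx =>
    obtain ⟨i, s, hs, v, hv, rfl⟩ := hx
    have h1 : (1 : S) ⊗ₜ v ∈ V.canonDeg μ 𝒮 i :=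
      Submodule.subset_span ⟨i, 1, by rw [sub_self]; exact SetLike.one_mem_graded 𝒮, v, hv, rfl⟩
    have h2 := smul_mem_canonDeg μ V hs (transfer_mem μ φ hφ V (hf i _ h1))
    rw [sub_add_cancel] at h2
    exact h2
  | zero => rw [map_zero]; exact zero_mem _
  | add x y _ _ hx hy => rw [map_add]; exact add_mem hx hy
  | smul w x _ hx =>
    rw [← algebraMap_smul S' w x, map_smul, algebraMap_smul]
    exact Submodule.smul_mem _ _ hx

theorem transfer_canonMap {V U : FreeRep O H} (f : V.carrier →ₗ[O] U.carrier) (x : V.Canon W S) :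
    transfer (U.Base W) φ (FreeRep.canonMap W S f x) =
      FreeRep.canonMap W S' f (transfer (V.Base W) φ x) := by
  induction x using TensorProduct.induction_on with
  | zero => simp only [map_zero]
  | tmul s v => rfl
  | add x y hx hy => simp only [map_add, hx, hy]

theorem transfer_canonTensor (V U : FreeRep O H) (x : V.Canon W S) (y : U.Canon W S) :
    transfer ((V.tensor U).Base W) φ (FreeRep.canonTensor W S V U (x ⊗ₜ y)) =
      FreeRep.canonTensor W S' V U (transfer (V.Base W) φ x ⊗ₜ transfer (U.Base W) φ y) := by
  induction x using TensorProduct.induction_on with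
  | zero => simp only [map_zero, TensorProduct.zero_tmul]
  | add x x' hx hx' => simp only [map_add, TensorProduct.add_tmul, hx, hx']
  | tmul s v =>
    induction y using TensorProduct.induction_on with
    | zero => simp only [map_zero, TensorProduct.tmul_zero]
    | add y y' hy hy' => simp only [map_add, TensorProduct.tmul_add, hy, hy']
    | tmul s' u =>
      rw [FreeRep.canonTensor_tmul, transfer_tmul, transfer_tmul, transfer_tmul,
        FreeRep.canonTensor_tmul, map_mul]

theorem isTensorAut_equivAlong [SetLike.GradedMonoid 𝒮] [SetLike.GradedMonoid 𝒮']
    (hφ : ∀ n, ∀ s ∈ 𝒮 n, φ s ∈ 𝒮' n)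
    {lam : ∀ V : FreeRep O H, V.Canon W S ≃ₗ[S] V.Canon W S} (hl : IsTensorAut μ 𝒮 lam) :
    IsTensorAut μ 𝒮' fun V => equivAlong φ (lam V) where
  graded V l x := by
    refine ⟨fun h => ?_, equivAlong_mem μ φ hφ V (lam V) fun l x => (hl.graded V l x).2⟩
    have h' := equivAlong_mem μ φ hφ V (lam V)⁻¹ (fun l x hx => by
      refine (hl.graded V l _).1 ?_
      rw [show lam V ((lam V)⁻¹ x) = x from LinearEquiv.apply_symm_apply _ _]
      exact hx) h
    rw [map_inv] at h'
    rwa [show (equivAlong φ (lam V))⁻¹ (equivAlong φ (lam V) x) = x from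
      LinearEquiv.symm_apply_apply _ _] at h'
  natural V U f hf := by
    refine ext_transfer φ (f := (equivAlong φ (lam U)).toLinearMap ∘ₗ FreeRep.canonMap W S' f)
      (g := FreeRep.canonMap W S' f ∘ₗ (equivAlong φ (lam V)).toLinearMap) fun x => ?_
    change equivAlong φ (lam U) (FreeRep.canonMap W S' f (transfer _ φ x)) =
      FreeRep.canonMap W S' f (equivAlong φ (lam V) (transfer _ φ x))
    rw [← transfer_canonMap, equivAlong_transfer, equivAlong_transfer, hl.natural V U f hf,
      transfer_canonMap]
  tensor V U x y := by
    refine ext_transfer φ (f := (equivAlong φ (lam (V.tensor U))).toLinearMap ∘ₗ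
        (FreeRep.canonTensor W S' V U).toLinearMap ∘ₗ (TensorProduct.mk S' _ _).flip y)
      (g := (FreeRep.canonTensor W S' V U).toLinearMap ∘ₗ
        (TensorProduct.mk S' _ _).flip (equivAlong φ (lam U) y) ∘ₗ
          (equivAlong φ (lam V)).toLinearMap) (fun x => ?_) x
    refine ext_transfer φ (f := (equivAlong φ (lam (V.tensor U))).toLinearMap ∘ₗ
        (FreeRep.canonTensor W S' V U).toLinearMap ∘ₗ TensorProduct.mk S' _ _ (transfer _ φ x))
      (g := (FreeRep.canonTensor W S' V U).toLinearMap ∘ₗ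
        TensorProduct.mk S' _ _ (equivAlong φ (lam V) (transfer _ φ x)) ∘ₗ
          (equivAlong φ (lam U)).toLinearMap) (fun y => ?_) y
    change equivAlong φ (lam (V.tensor U))
        (FreeRep.canonTensor W S' V U (transfer _ φ x ⊗ₜ transfer _ φ y)) =
      FreeRep.canonTensor W S' V U (equivAlong φ (lam V) (transfer _ φ x) ⊗ₜ
        equivAlong φ (lam U) (transfer _ φ y))
    rw [← transfer_canonTensor, equivAlong_transfer, equivAlong_transfer, equivAlong_transfer,
      hl.tensor, transfer_canonTensor]
  unit x := by
    refine ext_transfer φ (f := (equivAlong φ (lam (FreeRep.unit O H))).toLinearMap)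
      (g := LinearMap.id) (fun x => ?_) x
    change equivAlong φ (lam (FreeRep.unit O H)) (transfer _ φ x) = transfer _ φ x
    rw [equivAlong_transfer, hl.unit]

/-- The base change of tensor automorphisms along a homomorphism of graded `W`-algebras. -/
def tensorAutMap [SetLike.GradedMonoid 𝒮] [SetLike.GradedMonoid 𝒮']
    (hφ : ∀ n, ∀ s ∈ 𝒮 n, φ s ∈ 𝒮' n) :
    tensorAut μ 𝒮 →* tensorAut μ 𝒮' where
  toFun lam := ⟨fun V => equivAlong φ (lam.1 V), isTensorAut_equivAlong μ φ hφ lam.2⟩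
  map_one' := Subtype.ext (funext fun _ => map_one _)
  map_mul' lam κ := Subtype.ext (funext fun V => map_mul (equivAlong φ) (lam.1 V) (κ.1 V))

/-- The map `G(S)_μ → G(S')_μ` induced by a homomorphism of graded `W`-algebras. -/
def gradedPointsMap [GradedAlgebra 𝒮] [GradedAlgebra 𝒮']
    (hφ : ∀ n, ∀ s ∈ 𝒮 n, φ s ∈ 𝒮' n) :
    gradedPoints μ 𝒮 →* gradedPoints μ 𝒮' where
  toFun h := ⟨Points.map φ h.1, fun n f hf => hφ n _ (h.2 n f hf)⟩
  map_one' := Subtype.ext (map_one (Points.map φ))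
  map_mul' g h := Subtype.ext (map_mul (Points.map φ) g.1 h.1)

end TensorAut

/-! ### The functors and the site -/

section Site

universe a b c t

open CategoryTheory LaurentPolynomial

variable {p : ℕ} [hp : Fact p.Prime] {k : Type a} [Field k] [CharP k p] [PerfectRing k p]
  {A : Type b} [CommRing A] [HopfAlgebra ℤ_[p] A]
  (μ : (WittVector p k ⊗[ℤ_[p]] A) →ₐc[WittVector p k] (WittVector p k)[T;T⁻¹])

/-- The display group `L⁺_μ G`, as a functor on `W(k)`-algebras: `R ↦ G(W(R)^⊕)_μ`. -/
def displayGroup : CommAlgCat.{c} (WittVector p k) ⥤ GrpCat.{max 1 a b c} where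
  obj R := GrpCat.of (ULift.{1} (gradedPoints μ (wittDeg p k R)))
  map {R R'} φ := GrpCat.ofHom (MulEquiv.ulift.symm.toMonoidHom.comp
    ((gradedPointsMap μ (𝒮 := wittDeg p k R) (𝒮' := wittDeg p k R') (GradedWitt.mapAlg p φ.hom)
      fun _ _ hs => GradedWitt.map_mem p k _ hs).comp MulEquiv.ulift.toMonoidHom))
  map_id R := by
    refine GrpCat.hom_ext (MonoidHom.ext fun h => ULift.ext _ _ (Subtype.ext ?_))
    exact Points.ext (congrArg (fun ψ => AlgHom.comp ψ h.down.1.hom) (GradedWitt.mapAlg_id p k))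
  map_comp φ ψ := by
    refine GrpCat.hom_ext (MonoidHom.ext fun h => ULift.ext _ _ (Subtype.ext ?_))
    exact Points.ext (congrArg (fun ψ => AlgHom.comp ψ h.down.1.hom)
      (GradedWitt.mapAlg_comp p k ψ.hom φ.hom))

/-- The functor `Aut^⊗(C_μ)` on `W(k)`-algebras: its value at `R` is the group of tensor
automorphisms of the canonical graded fiber functor `V ↦ V_{W(k)} ⊗ W(R)^⊕`. -/
def tensorAutGroup : CommAlgCat.{c} (WittVector p k) ⥤ GrpCat.{max 1 a b c} where
  obj R := GrpCat.of (tensorAut μ (wittDeg p k R))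
  map {R R'} φ := GrpCat.ofHom (tensorAutMap μ (𝒮 := wittDeg p k R) (𝒮' := wittDeg p k R')
    (GradedWitt.mapAlg p φ.hom)
    fun _ _ hs => GradedWitt.map_mem p k _ hs)
  map_id R := by
    refine GrpCat.hom_ext (MonoidHom.ext fun lam => Subtype.ext (funext fun V => ?_))
    exact (congrArg (fun ψ => equivAlong ψ (lam.1 V)) (GradedWitt.mapAlg_id p k)).trans
      (equivAlong_id _)
  map_comp φ ψ := by
    refine GrpCat.hom_ext (MonoidHom.ext fun lam => Subtype.ext (funext fun V => ?_))
    exact (congrArg (fun ψ => equivAlong ψ (lam.1 V))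
      (GradedWitt.mapAlg_comp p k ψ.hom φ.hom)).trans (equivAlong_comp _ _ _)

variable (p k) in
/-- The category of `W(k)`-algebras in which `p` is nilpotent. -/
abbrev Nilp : Type _ :=
  ObjectProperty.FullSubcategory fun R : CommAlgCat.{c} (WittVector p k) => IsNilpotent (p : R)

variable (p k) in
/-- The inclusion of `p`-nilpotent `W(k)`-algebras into all `W(k)`-algebras. -/
abbrev nilpInclusion : Nilp.{a, c} p k ⥤ CommAlgCat.{c} (WittVector p k) :=
  ObjectProperty.ι _

/-- A finite family of homomorphisms `R → R_i` is an fpqc covering of `Spec R` if `R → ∏ R_i` is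
faithfully flat. -/
def IsFpqcCover {R : Nilp.{a, c} p k} {n : ℕ} {X : Fin n → Nilp.{a, c} p k}
    (f : ∀ i, R ⟶ X i) : Prop :=
  (RingHom.pi fun i => ((f i).hom.hom : R.obj →+* (X i).obj)).FaithfullyFlat

/-- The sheaf condition for the fpqc topology on the category of (spectra of) `p`-nilpotent
`W(k)`-algebras: compatible families on fpqc coverings glue uniquely. -/
def IsFpqcSheaf (F : Nilp.{a, c} p k ⥤ GrpCat.{t}) : Prop :=
  ∀ (R : Nilp.{a, c} p k) (n : ℕ) (X : Fin n → Nilp.{a, c} p k) (f : ∀ i, R ⟶ X i),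
    IsFpqcCover f → ∀ x : ∀ i, F.obj (X i),
      (∀ (i j : Fin n) (Y : Nilp.{a, c} p k) (g : X i ⟶ Y) (h : X j ⟶ Y),
        f i ≫ g = f j ≫ h → F.map g (x i) = F.map h (x j)) →
      ∃! y : F.obj R, ∀ i, F.map (f i) y = x i

end Site

end GDisplay

end

universe a b c

open GDisplay CategoryTheory

/-! The isomorphism is a Tannakian reconstruction with a grading carried along, and it holds for
every graded `W`-algebra `S` in place of the graded Witt ring (`gradedPointsToAut_bijective`).

Reconstruction without the grading. Over a principal ideal domain `O` with `H` flat, every finitely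
generated submodule of `H` lies in a finite free subcomodule (`exists_isCoordMap`), so every
function on the group is a matrix coefficient of some `V`. Given a tensor endomorphism `lam` of `V ↦
S ⊗ V_W`, the function that is the coefficient of `(l, v)` is sent to the scalar `l (lam v)`. Two
representations with a common coefficient map to one subrepresentation of `H`, so naturality makes
this well defined (`canonForm_natural_eq`). Compatibility with tensor products makes it
multiplicative and the unit object gives `1 ↦ 1`. The resulting point acts as `lam`
(`exists_point_act`), and it is unique since matrix coefficients exhaust `H` (`points_ext_act`).

The grading. Gradings are `𝔾_m`-actions, so everything is compared over `S[T;T⁻¹]`. A point `h`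
preserves the gradings iff its transform under the coaction of `S` is `μ(T)⁻¹ h μ(T)`. A vector of
`S ⊗ V_W` has degree `l` iff the coaction of `S` followed by `ρ(μ(T))` multiplies it by `T ^ l`
(`canonCoact_of_mem`, `mem_of_canonCoact`). These two criteria translate into each other:
`act_mem_canonDeg` in one direction and, because the representations are jointly faithful,
`mem_gradedPoints_of_act` in the other.

The sheaf property. A faithfully flat `R → ∏ X_i` identifies `R` with the compatible families in the
`X_i`. This passes to Witt vectors coefficient by coefficient and to `W(R)^⊕` degree by degree, and
hence to algebra homomorphisms from the coordinate ring into `W(R)^⊕` (`isFpqcSheaf_displayGroup`).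
The functor of tensor automorphisms inherits the property through the isomorphism. -/

noncomputable section

namespace GDisplay

/-! ### Action of a point on the base changes of representations. -/

section Theta

universe u v

variable {O : Type u} {H : Type v} [CommRing O] [CommRing H] [HopfAlgebra O H]
  {W : Type*} [CommRing W] [Algebra O W] {B B' : Type*} [CommRing B] [Algebra W B]
  [CommRing B'] [Algebra W B']

/-- The vectors `1 ⊗ (1 ⊗ v)` generate the double base change over `B`. Nearly every identity
between actions below is checked on them only. -/
theorem canon_ext {V : Type*} [AddCommGroup V] [Module O V] {P : Type*} [AddCommGroup P]
    [Module B P] {f g : B ⊗[W] (W ⊗[O] V) →ₗ[B] P}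
    (h : ∀ v : V, f (1 ⊗ₜ (1 ⊗ₜ v)) = g (1 ⊗ₜ (1 ⊗ₜ v))) : f = g := by
  refine LinearMap.ext fun x => ?_
  induction x with
  | zero => simp
  | add x y hx hy => simp only [map_add, hx, hy]
  | tmul b m =>
    induction m with
    | zero => simp
    | add x y hx hy => simp only [TensorProduct.tmul_add, map_add, hx, hy]
    | tmul w v =>
      have e : b ⊗ₜ[W] (w ⊗ₜ[O] v) = (b * algebraMap W B w) • ((1 : B) ⊗ₜ[W] ((1 : W) ⊗ₜ[O] v)) := by
        rw [TensorProduct.smul_tmul', smul_eq_mul, mul_one, mul_comm, ← Algebra.smul_def,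
          TensorProduct.smul_tmul, TensorProduct.smul_tmul', smul_eq_mul, mul_one]
      rw [e, map_smul, map_smul, h]

section

variable {Q Q' V U : Type*} [AddCommGroup Q] [Module O Q] [AddCommGroup Q'] [Module O Q']
  [AddCommGroup V] [Module O V] [AddCommGroup U] [Module O U]

theorem base_ext {φ ψ : W ⊗[O] Q →ₗ[W] B} (h : ∀ q : Q, φ (1 ⊗ₜ q) = ψ (1 ⊗ₜ q)) : φ = ψ := by
  refine LinearMap.ext fun x => ?_
  induction x with
  | zero => simp
  | add x y hx hy => simp only [map_add, hx, hy]
  | tmul w q =>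
    rw [← mul_one w, ← smul_eq_mul, ← TensorProduct.smul_tmul', map_smul, map_smul, h]

variable (V) in
/-- The map `V ⊗ Q → B ⊗ V_W` with `v ⊗ q ↦ φ (1 ⊗ q) ⊗ (1 ⊗ v)`. -/
def evalCoeff (φ : W ⊗[O] Q →ₗ[W] B) : V ⊗[O] Q →+ B ⊗[W] (W ⊗[O] V) :=
  ((TensorProduct.comm W (W ⊗[O] V) B).toLinearMap ∘ₗ φ.lTensor (W ⊗[O] V) ∘ₗ
    (TensorProduct.AlgebraTensorModule.distribBaseChange O W V Q).toLinearMap).toAddMonoidHom.comp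
    (TensorProduct.mk O W (V ⊗[O] Q) 1).toAddMonoidHom

theorem evalCoeff_tmul (φ : W ⊗[O] Q →ₗ[W] B) (v : V) (q : Q) :
    evalCoeff V φ (v ⊗ₜ q) = φ (1 ⊗ₜ q) ⊗ₜ (1 ⊗ₜ v) := rfl

/-- Naturality in the coefficient module; the next two lemmas give it in `V` and in `B`. Through
these, identities between coactions become identities between actions. -/
theorem evalCoeff_lTensor (φ : W ⊗[O] Q' →ₗ[W] B) (ψ : Q →ₗ[O] Q') (y : V ⊗[O] Q) :
    evalCoeff V φ (ψ.lTensor V y) = evalCoeff V (φ ∘ₗ ψ.baseChange W) y := by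
  induction y with
  | zero => simp
  | add x y hx hy => simp only [map_add, hx, hy]
  | tmul v q => rfl

theorem evalCoeff_rTensor (φ : W ⊗[O] Q →ₗ[W] B) (f : V →ₗ[O] U) (y : V ⊗[O] Q) :
    evalCoeff U φ (f.rTensor Q y) = (f.baseChange W).baseChange B (evalCoeff V φ y) := by
  induction y with
  | zero => simp
  | add x y hx hy => simp only [map_add, hx, hy]
  | tmul v q => rfl

theorem transfer_evalCoeff (φ : W ⊗[O] Q →ₗ[W] B) (ψ : B →ₐ[W] B') (y : V ⊗[O] Q) :
    transfer (W ⊗[O] V) ψ (evalCoeff V φ y) = evalCoeff V (ψ.toLinearMap ∘ₗ φ) y := by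
  induction y with
  | zero => simp
  | add x y hx hy => simp only [map_add, hx, hy]
  | tmul v q => rfl

variable (W B) in
/-- The linear form on `B ⊗ V_W` that is induced by a linear form on `V`. -/
def canonForm (l : V →ₗ[O] O) : B ⊗[W] (W ⊗[O] V) →ₗ[B] B :=
  LinearMap.liftBaseChange B (Algebra.linearMap W B ∘ₗ
    (TensorProduct.AlgebraTensorModule.rid O W W).toLinearMap ∘ₗ l.baseChange W)

theorem canonForm_tmul (l : V →ₗ[O] O) (b : B) (w : W) (v : V) :
    canonForm W B l (b ⊗ₜ (w ⊗ₜ v)) = b * algebraMap W B (l v • w) := rfl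

theorem canonForm_one_tmul (l : V →ₗ[O] O) (b : B) (v : V) :
    canonForm W B l (b ⊗ₜ (1 ⊗ₜ v)) = b * algebraMap W B (algebraMap O W (l v)) := by
  rw [canonForm_tmul, Algebra.smul_def, mul_one]

/-- Contracting `V` with `l` commutes with evaluating the other factor by `φ`. Applied to a
coaction, this says that the coefficients of `ρ(h)` are values of `h`. -/
theorem canonForm_evalCoeff (l : V →ₗ[O] O) (φ : W ⊗[O] Q →ₗ[W] B) (y : V ⊗[O] Q) :
    canonForm W B l (evalCoeff V φ y) = φ (1 ⊗ₜ (TensorProduct.lid O Q (l.rTensor Q y))) := by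
  induction y with
  | zero => simp
  | add x y hx hy => simp only [map_add, hx, hy, TensorProduct.tmul_add]
  | tmul v q =>
    rw [evalCoeff_tmul, canonForm_one_tmul, LinearMap.rTensor_tmul, TensorProduct.lid_tmul,
      TensorProduct.tmul_smul, ← algebraMap_smul W, map_smul, Algebra.smul_def, mul_comm]

theorem canonForm_baseChange (l : U →ₗ[O] O) (f : V →ₗ[O] U) (x : B ⊗[W] (W ⊗[O] V)) :
    canonForm W B l ((f.baseChange W).baseChange B x) = canonForm W B (l ∘ₗ f) x := by
  refine LinearMap.congr_fun (f := canonForm W B l ∘ₗ (f.baseChange W).baseChange B) ?_ x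
  exact canon_ext fun v => rfl

/-- The base-changed dual basis consists of the coordinate functions of the basis `1 ⊗ (1 ⊗ b i)`.
-/
theorem canonForm_sum_basis {ι : Type*} [Fintype ι] (b : Module.Basis ι O V)
    (x : B ⊗[W] (W ⊗[O] V)) :
    x = ∑ i, canonForm W B (b.coord i) x • ((1 : B) ⊗ₜ[W] ((1 : W) ⊗ₜ[O] b i)) := by
  refine LinearMap.congr_fun (f := LinearMap.id)
    (g := ∑ i, (canonForm W B (b.coord i)).smulRight ((1 : B) ⊗ₜ[W] ((1 : W) ⊗ₜ[O] b i)))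
    (canon_ext fun v => ?_) x |>.trans ?_
  · have hv : (1 : B) ⊗ₜ[W] ((1 : W) ⊗ₜ[O] v) =
        ∑ i, (1 : B) ⊗ₜ[W] ((1 : W) ⊗ₜ[O] (b.repr v i • b i)) := by
      rw [← TensorProduct.tmul_sum, ← TensorProduct.tmul_sum, b.sum_repr]
    rw [LinearMap.id_apply, LinearMap.sum_apply, hv]
    refine Finset.sum_congr rfl fun i _ => ?_
    rw [LinearMap.smulRight_apply, ← hv, canonForm_one_tmul, one_mul, TensorProduct.tmul_smul,
      algebraMap_smul, ← algebraMap_smul W, TensorProduct.tmul_smul]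
    rfl
  · simp

theorem canon_ext_form [Module.Free O V] [Module.Finite O V] {x y : B ⊗[W] (W ⊗[O] V)}
    (h : ∀ l : V →ₗ[O] O, canonForm W B l x = canonForm W B l y) : x = y := by
  have b := Module.Free.chooseBasis O V
  rw [canonForm_sum_basis b x, canonForm_sum_basis b y]
  simp only [h]

end

namespace FreeRep

/-- On vectors of `V` the action is the coaction followed by `h` on the coefficients; with
`canon_ext` this determines it. -/
theorem act_tmul (V : FreeRep O H) (h : Points W (W ⊗[O] H) B) (v : V.carrier) :
    V.act h (1 ⊗ₜ (1 ⊗ₜ v)) = evalCoeff V.carrier h.hom.toLinearMap (V.coact v) := by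
  change (1 : B) • evalCoeff V.carrier h.hom.toLinearMap (V.coact v) = _
  rw [one_smul]

theorem transfer_act (V : FreeRep O H) (ψ : B →ₐ[W] B') (h : Points W (W ⊗[O] H) B)
    (x : V.Canon W B) :
    transfer (V.Base W) ψ (V.act h x) = V.act (Points.map ψ h) (transfer (V.Base W) ψ x) := by
  rw [← baseChangeAlong_transfer]
  refine LinearMap.congr_fun (canon_ext fun v => ?_) _
  rw [act_tmul, baseChangeAlong_tmul, one_smul, act_tmul, transfer_evalCoeff]
  rfl

theorem act_one (V : FreeRep O H) : V.act (1 : Points W (W ⊗[O] H) B) = LinearMap.id := by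
  refine canon_ext fun v => ?_
  rw [act_tmul]
  -- The unit point is the base change of the counit of `H`, so the counit axiom of the comodule
  -- finishes the computation.
  have h1 : (1 : Points W (W ⊗[O] H) B).hom.toLinearMap =
      (Algebra.linearMap W B ∘ₗ (TensorProduct.AlgebraTensorModule.rid O W W).toLinearMap) ∘ₗ
        (Coalgebra.counit (R := O) (A := H)).baseChange W := by
    refine base_ext fun a => ?_
    change algebraMap W B (Coalgebra.counit (R := W) ((1 : W) ⊗ₜ[O] a)) = _
    rw [TensorProduct.counit_tmul]
    rfl
  have h2 : ∀ z : V.carrier ⊗[O] O, evalCoeff V.carrier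
      (Algebra.linearMap W B ∘ₗ (TensorProduct.AlgebraTensorModule.rid O W W).toLinearMap) z =
        1 ⊗ₜ (1 ⊗ₜ TensorProduct.rid O V.carrier z) := by
    intro z
    induction z with
    | zero => simp
    | add x y hx hy => simp only [map_add, hx, hy, TensorProduct.tmul_add]
    | tmul v r =>
      change algebraMap W B (r • (1 : W)) ⊗ₜ[W] ((1 : W) ⊗ₜ[O] v) = 1 ⊗ₜ[W] (1 ⊗ₜ[O] (r • v))
      rw [Algebra.algebraMap_eq_smul_one, TensorProduct.smul_tmul, TensorProduct.smul_tmul',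
        smul_assoc, one_smul, TensorProduct.smul_tmul]
  rw [h1, ← evalCoeff_lTensor, h2]
  exact congrArg (fun x => (1 : B) ⊗ₜ[W] ((1 : W) ⊗ₜ[O] x)) (LinearMap.congr_fun V.coact_counit v)

/-- This is coassociativity: applying `h` and then `g` coacts twice, while `g * h` evaluates the
comultiplication of the coefficient. -/
theorem act_mul (V : FreeRep O H) (g h : Points W (W ⊗[O] H) B) :
    V.act (g * h) = V.act g ∘ₗ V.act h := by
  refine canon_ext fun v => ?_
  rw [LinearMap.comp_apply, act_tmul, act_tmul]
  -- This is `a ⊗ b ↦ g a * h b`, so that both sides become `evalCoeff` of `φ` on an element of `V ⊗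
  -- (H ⊗ H)`.
  set φ : W ⊗[O] (H ⊗[O] H) →ₗ[W] B :=
    (Algebra.TensorProduct.lift g.hom h.hom fun _ _ => .all ..).toLinearMap ∘ₗ
      (TensorProduct.AlgebraTensorModule.distribBaseChange O W H H).toLinearMap with hφ
  have h1 : (g * h).hom.toLinearMap = φ ∘ₗ (Coalgebra.comul (R := O) (A := H)).baseChange W := by
    refine base_ext fun a => ?_
    have h0 : ∀ z : H ⊗[O] H, TensorProduct.AlgebraTensorModule.tensorTensorTensorComm O W O W
        W W H H ((1 ⊗ₜ 1) ⊗ₜ z) =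
        TensorProduct.AlgebraTensorModule.distribBaseChange O W H H (1 ⊗ₜ z) := by
      intro z
      induction z with
      | zero => simp
      | add x y hx hy => simp only [map_add, hx, hy, TensorProduct.tmul_add]
      | tmul a b => rfl
    change (g * h).hom (1 ⊗ₜ a) = φ (1 ⊗ₜ Coalgebra.comul (R := O) a)
    rw [Points.mul_hom_apply, TensorProduct.comul_tmul]
    exact congrArg _ (h0 _)
  have h2 : ∀ y : V.carrier ⊗[O] H, V.act g (evalCoeff V.carrier h.hom.toLinearMap y) =
      evalCoeff V.carrier φ (TensorProduct.assoc O V.carrier H H (V.coact.rTensor H y)) := by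
    intro y
    induction y with
    | zero => simp
    | add x y hx hy => simp only [map_add, hx, hy]
    | tmul v a =>
      have h3 : ∀ z : V.carrier ⊗[O] H, h.hom (1 ⊗ₜ a) • evalCoeff V.carrier g.hom.toLinearMap z =
          evalCoeff V.carrier φ (TensorProduct.assoc O V.carrier H H (z ⊗ₜ a)) := by
        intro z
        induction z with
        | zero => simp
        | add x y hx hy => simp only [map_add, hx, hy, smul_add, TensorProduct.add_tmul]
        | tmul v c =>
          rw [evalCoeff_tmul, TensorProduct.assoc_tmul, evalCoeff_tmul, TensorProduct.smul_tmul',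
            smul_eq_mul, mul_comm]
          simp [hφ]
      rw [LinearMap.rTensor_tmul, ← h3, evalCoeff_tmul, ← act_tmul, ← map_smul,
        TensorProduct.smul_tmul', smul_eq_mul, mul_one]
      rfl
  rw [h2, h1, ← evalCoeff_lTensor]
  exact congrArg _ (LinearMap.congr_fun V.coact_assoc v).symm

theorem act_canonMap {V U : FreeRep O H} {f : V.carrier →ₗ[O] U.carrier} (hf : IsHom V U f)
    (h : Points W (W ⊗[O] H) B) (x : V.Canon W B) :
    U.act h (canonMap W B f x) = canonMap W B f (V.act h x) := by
  refine LinearMap.congr_fun (f := U.act h ∘ₗ canonMap W B f) (g := canonMap W B f ∘ₗ V.act h)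
    (canon_ext fun v => ?_) x
  rw [LinearMap.comp_apply, LinearMap.comp_apply, act_tmul]
  refine (U.act_tmul h (f v)).trans ?_
  rw [canonMap, ← evalCoeff_rTensor]
  exact congrArg _ (LinearMap.congr_fun hf v).symm

/-- The coaction on a tensor product multiplies coefficients, and `h` is multiplicative. -/
theorem act_canonTensor (V U : FreeRep O H) (h : Points W (W ⊗[O] H) B) (x : V.Canon W B)
    (y : U.Canon W B) :
    (V.tensor U).act h (canonTensor W B V U (x ⊗ₜ y)) =
      canonTensor W B V U (V.act h x ⊗ₜ U.act h y) := by
  have key : ∀ (y : V.carrier ⊗[O] H) (z : U.carrier ⊗[O] H),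
      canonTensor W B V U (evalCoeff V.carrier h.hom.toLinearMap y ⊗ₜ
        evalCoeff U.carrier h.hom.toLinearMap z) =
      evalCoeff (V.carrier ⊗[O] U.carrier) h.hom.toLinearMap
        (mulCoact O V.carrier U.carrier H (y ⊗ₜ z)) := by
    intro y z
    induction y with
    | zero => simp; rfl
    | add x y hx hy => simp only [map_add, hx, hy, TensorProduct.add_tmul]; rfl
    | tmul v a =>
      induction z with
      | zero => simp; rfl
      | add x y hx hy => simp only [map_add, hx, hy, TensorProduct.tmul_add]; rfl
      | tmul u b =>
        rw [evalCoeff_tmul, evalCoeff_tmul, canonTensor_tmul, mulCoact_tmul, baseTensor_tmul]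
        rw [evalCoeff_tmul, mul_one, AlgHom.toLinearMap_apply, AlgHom.toLinearMap_apply, AlgHom.toLinearMap_apply,
          ← map_mul, Algebra.TensorProduct.tmul_mul_tmul, mul_one]
        rfl
  refine LinearMap.congr_fun (f := (V.tensor U).act h ∘ₗ (canonTensor W B V U).toLinearMap ∘ₗ
    (TensorProduct.mk B _ _).flip y) (g := (canonTensor W B V U).toLinearMap ∘ₗ
      (TensorProduct.mk B _ _).flip (U.act h y) ∘ₗ V.act h) (canon_ext fun v => ?_) x
  refine LinearMap.congr_fun (f := (V.tensor U).act h ∘ₗ (canonTensor W B V U).toLinearMap ∘ₗ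
    TensorProduct.mk B _ _ (1 ⊗ₜ (1 ⊗ₜ v))) (g := (canonTensor W B V U).toLinearMap ∘ₗ
      TensorProduct.mk B _ _ (V.act h (1 ⊗ₜ (1 ⊗ₜ v))) ∘ₗ U.act h) (canon_ext fun u => ?_) y
  change (V.tensor U).act h (canonTensor W B V U ((1 ⊗ₜ (1 ⊗ₜ v)) ⊗ₜ (1 ⊗ₜ (1 ⊗ₜ u)))) =
    canonTensor W B V U (V.act h (1 ⊗ₜ (1 ⊗ₜ v)) ⊗ₜ U.act h (1 ⊗ₜ (1 ⊗ₜ u)))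
  rw [act_tmul, act_tmul, key, canonTensor_tmul, mul_one, baseTensor_tmul, mul_one]
  exact act_tmul (V.tensor U) h (v ⊗ₜ u)

theorem act_unit (h : Points W (W ⊗[O] H) B) (x : (unit O H).Canon W B) :
    (unit O H).act h x = x := by
  refine LinearMap.congr_fun (f := (unit O H).act h) (g := LinearMap.id) (canon_ext fun v => ?_) x
  rw [act_tmul]
  refine (evalCoeff_tmul (V := O) _ v (1 : H)).trans ?_
  rw [AlgHom.toLinearMap_apply, ← Algebra.TensorProduct.one_def, map_one]
  rfl

/-- The action of a point, as a linear automorphism. -/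
def actEquiv (V : FreeRep O H) (h : Points W (W ⊗[O] H) B) :
    V.Canon W B ≃ₗ[B] V.Canon W B :=
  LinearEquiv.ofLinearMap (V.act h) (V.act h⁻¹)
    (by rw [← act_mul, mul_inv_cancel, act_one]) (by rw [← act_mul, inv_mul_cancel, act_one])

end FreeRep

end Theta

/-! ### Matrix coefficients and local finiteness of the regular representation. -/

section Coefficients

universe u v

variable {O : Type u} {H : Type v} [CommRing O] [CommRing H] [HopfAlgebra O H]

namespace FreeRep

/-- A linear map from a representation to the regular representation that commutes with the
coactions. -/
def IsCoordMap (V : FreeRep O H) (j : V.carrier →ₗ[O] H) : Prop :=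
  j.rTensor H ∘ₗ V.coact = Coalgebra.comul (R := O) (A := H) ∘ₗ j

/-- The matrix coefficients `v ↦ (l ⊗ 1) (ρ v)` of a representation. -/
def matrixCoeff (V : FreeRep O H) (l : V.carrier →ₗ[O] O) : V.carrier →ₗ[O] H :=
  (TensorProduct.lid O H).toLinearMap ∘ₗ l.rTensor H ∘ₗ V.coact

/-- Coassociativity with the `V`-factor contracted by `l`. Together with the next two lemmas it
gives a bijection between linear forms on `V` and equivariant maps `V → H`, with inverse `j ↦ ε ∘
j`. -/
theorem isCoordMap_matrixCoeff (V : FreeRep O H) (l : V.carrier →ₗ[O] O) :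
    V.IsCoordMap (V.matrixCoeff l) := by
  refine LinearMap.ext fun v => ?_
  have h1 : ∀ z : V.carrier ⊗[O] H ⊗[O] H,
      (((TensorProduct.lid O H).toLinearMap ∘ₗ l.rTensor H).rTensor H) z =
        TensorProduct.lid O (H ⊗[O] H) (l.rTensor (H ⊗[O] H)
          (TensorProduct.assoc O V.carrier H H z)) := by
    intro z
    refine LinearMap.congr_fun (f := ((TensorProduct.lid O H).toLinearMap ∘ₗ l.rTensor H).rTensor H)
      (g := (TensorProduct.lid O (H ⊗[O] H)).toLinearMap ∘ₗ l.rTensor (H ⊗[O] H) ∘ₗ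
        (TensorProduct.assoc O V.carrier H H).toLinearMap) ?_ z
    ext v a b
    simp [TensorProduct.smul_tmul']
  have h2 : ∀ y : V.carrier ⊗[O] H,
      Coalgebra.comul (R := O) (TensorProduct.lid O H (l.rTensor H y)) =
        TensorProduct.lid O (H ⊗[O] H) (l.rTensor (H ⊗[O] H)
          ((Coalgebra.comul (R := O) (A := H)).lTensor V.carrier y)) := by
    intro y
    induction y with
    | zero => simp
    | add x y hx hy => simp only [map_add, hx, hy]
    | tmul v a => simp
  have h := LinearMap.congr_fun V.coact_assoc v
  simp only [LinearMap.comp_apply, LinearEquiv.coe_coe] at h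
  change (((TensorProduct.lid O H).toLinearMap ∘ₗ l.rTensor H) ∘ₗ V.coact).rTensor H
    (V.coact v) = Coalgebra.comul (R := O) (TensorProduct.lid O H (l.rTensor H (V.coact v)))
  rw [h2, ← h, ← h1, LinearMap.rTensor_comp, LinearMap.comp_apply]

theorem counit_matrixCoeff (V : FreeRep O H) (l : V.carrier →ₗ[O] O) :
    Coalgebra.counit (R := O) (A := H) ∘ₗ V.matrixCoeff l = l := by
  refine LinearMap.ext fun v => ?_
  have h1 : ∀ y : V.carrier ⊗[O] H,
      Coalgebra.counit (R := O) (TensorProduct.lid O H (l.rTensor H y)) =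
        l (TensorProduct.rid O V.carrier
          ((Coalgebra.counit (R := O) (A := H)).lTensor V.carrier y)) := by
    intro y
    induction y with
    | zero => simp
    | add x y hx hy => simp only [map_add, hx, hy]
    | tmul v a => simp [mul_comm]
  exact (h1 _).trans (congrArg l (LinearMap.congr_fun V.coact_counit v))

theorem IsCoordMap.matrixCoeff_eq {V : FreeRep O H} {j : V.carrier →ₗ[O] H}
    (hj : V.IsCoordMap j) :
    V.matrixCoeff (Coalgebra.counit (R := O) (A := H) ∘ₗ j) = j := by
  refine LinearMap.ext fun v => ?_
  change TensorProduct.lid O H ((Coalgebra.counit (R := O) (A := H) ∘ₗ j).rTensor H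
    (V.coact v)) = j v
  rw [LinearMap.rTensor_comp, LinearMap.comp_apply]
  have h := LinearMap.congr_fun hj v
  simp only [LinearMap.comp_apply] at h
  rw [h, Coalgebra.rTensor_counit_comul, TensorProduct.lid_tmul, one_smul]

/-- The factorization exists because `j` is injective. It is equivariant because `j ⊗ H` is still
injective by flatness, and after `j ⊗ H` both sides become the comultiplication of `c v`. -/
theorem IsCoordMap.exists_factor [Module.Flat O H] {V U : FreeRep O H} {c : V.carrier →ₗ[O] H}
    {j : U.carrier →ₗ[O] H} (hc : V.IsCoordMap c) (hj : U.IsCoordMap j)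
    (hinj : Function.Injective j) (hr : LinearMap.range c ≤ LinearMap.range j) :
    ∃ g : V.carrier →ₗ[O] U.carrier, IsHom V U g ∧ j ∘ₗ g = c := by
  let e := LinearEquiv.ofInjective j hinj
  let g : V.carrier →ₗ[O] U.carrier := e.symm.toLinearMap ∘ₗ
    c.codRestrict (LinearMap.range j) fun v => hr ⟨v, rfl⟩
  have hg : j ∘ₗ g = c := by
    refine LinearMap.ext fun v => ?_
    exact congrArg Subtype.val (e.apply_symm_apply ⟨c v, hr ⟨v, rfl⟩⟩)
  refine ⟨g, LinearMap.ext fun v => ?_, hg⟩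
  refine Module.Flat.rTensor_preserves_injective_linearMap (M := H) j hinj ?_
  have h1 := LinearMap.congr_fun hc v
  have h2 := LinearMap.congr_fun hj (g v)
  have h3 := LinearMap.congr_fun hg v
  simp only [LinearMap.comp_apply] at h1 h2 h3 ⊢
  rw [h2, h3, ← h1, ← LinearMap.comp_apply, ← LinearMap.rTensor_comp, hg]

/-- An injective linear map from a finite free module to `H` whose image is stable under the
comultiplication comes from a representation. -/
theorem exists_coact_of_injective [Module.Flat O H] {X : Type u} [AddCommGroup X] [Module O X]
    [Module.Free O X] [Module.Finite O X] (j : X →ₗ[O] H) (hinj : Function.Injective j)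
    (hj : ∀ x, Coalgebra.comul (R := O) (j x) ∈ LinearMap.range (j.rTensor H)) :
    ∃ (U : FreeRep O H) (i : U.carrier →ₗ[O] H), U.IsCoordMap i ∧ Function.Injective i ∧
      LinearMap.range i = LinearMap.range j := by
  have hinj' := Module.Flat.rTensor_preserves_injective_linearMap (M := H) j hinj
  let e := LinearEquiv.ofInjective (j.rTensor H) hinj'
  -- The coaction is the comultiplication of `j x`, lifted through `j ⊗ H`, which is injective by
  -- flatness.
  let ρ : X →ₗ[O] X ⊗[O] H := e.symm.toLinearMap ∘ₗ
    (Coalgebra.comul (R := O) (A := H) ∘ₗ j).codRestrict (LinearMap.range (j.rTensor H)) hj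
  have hρ : j.rTensor H ∘ₗ ρ = Coalgebra.comul (R := O) (A := H) ∘ₗ j := by
    refine LinearMap.ext fun v => ?_
    exact congrArg Subtype.val (e.apply_symm_apply ⟨Coalgebra.comul (R := O) (j v), hj v⟩)
  have hρ' : ∀ v, j.rTensor H (ρ v) = Coalgebra.comul (R := O) (j v) :=
    fun v => LinearMap.congr_fun hρ v
  refine ⟨{ carrier := X, coact := ρ, coact_assoc := ?_, coact_counit := ?_ }, j, hρ, hinj, rfl⟩
  · refine LinearMap.ext fun v => ?_
    -- After the injective map `j ⊗ (H ⊗ H)` the comodule axiom becomes coassociativity of `H`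
    -- itself.
    refine Module.Flat.rTensor_preserves_injective_linearMap (M := H ⊗[O] H) j hinj ?_
    have h1 : ∀ z : (X ⊗[O] H) ⊗[O] H, j.rTensor (H ⊗[O] H) (TensorProduct.assoc O X H H z) =
        TensorProduct.assoc O H H H ((j.rTensor H).rTensor H z) := by
      intro z
      refine LinearMap.congr_fun (f := j.rTensor (H ⊗[O] H) ∘ₗ
        (TensorProduct.assoc O X H H).toLinearMap) (g :=
          (TensorProduct.assoc O H H H).toLinearMap ∘ₗ (j.rTensor H).rTensor H) ?_ z
      ext a b c
      rfl
    have h2 := LinearMap.congr_fun (Coalgebra.coassoc (R := O) (A := H)) (j v)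
    simp only [LinearMap.comp_apply, LinearEquiv.coe_coe] at h2 ⊢
    rw [h1, ← LinearMap.comp_apply (LinearMap.rTensor H (LinearMap.rTensor H j)),
      ← LinearMap.rTensor_comp, hρ, LinearMap.rTensor_comp, LinearMap.comp_apply, hρ', h2,
      ← LinearMap.comp_apply (LinearMap.rTensor _ j), LinearMap.rTensor_comp_lTensor,
      ← LinearMap.lTensor_comp_rTensor, LinearMap.comp_apply, hρ']
  · refine LinearMap.ext fun v => hinj ?_
    have h1 : ∀ z : X ⊗[O] H, j (TensorProduct.rid O X
        ((Coalgebra.counit (R := O) (A := H)).lTensor X z)) =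
        TensorProduct.rid O H ((Coalgebra.counit (R := O) (A := H)).lTensor H
          (j.rTensor H z)) := by
      intro z
      induction z with
      | zero => simp
      | add x y hx hy => simp only [map_add, hx, hy]
      | tmul a b => simp
    simp only [LinearMap.comp_apply, LinearEquiv.coe_coe]
    rw [h1, hρ', Coalgebra.lTensor_counit_comul, TensorProduct.rid_tmul, one_smul]
    rfl

/-- Local finiteness of the regular representation: every finitely generated submodule of `H` is
contained in a subrepresentation that is finite and free. -/
theorem exists_isCoordMap [IsDomain O] [IsPrincipalIdealRing O] [Module.Flat O H]
    (N : Submodule O H) (hN : N.FG) :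
    ∃ (U : FreeRep O H) (j : U.carrier →ₗ[O] H), U.IsCoordMap j ∧ Function.Injective j ∧
      N ≤ LinearMap.range j := by
  -- Each comultiplication is a finite sum `∑ a ⊗ b`; let `F` be generated by the left factors
  -- occurring for the generators of `N`.
  obtain ⟨F, hF, hNF⟩ : ∃ F : Submodule O H, F.FG ∧
      ∀ x ∈ N, Coalgebra.comul (R := O) x ∈ LinearMap.range (F.subtype.rTensor H) := by
    obtain ⟨s, rfl⟩ := hN
    have h1 : ∀ z : H ⊗[O] H, ∃ F : Submodule O H, F.FG ∧
        z ∈ LinearMap.range (F.subtype.rTensor H) := by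
      intro z
      induction z with
      | zero => exact ⟨⊥, Submodule.fg_bot, zero_mem _⟩
      | tmul a b =>
        refine ⟨O ∙ a, Submodule.fg_span_singleton a,
          ⟨a, Submodule.mem_span_singleton_self a⟩ ⊗ₜ b, rfl⟩
      | add x y hx hy =>
        obtain ⟨F, hF, hx⟩ := hx
        obtain ⟨F', hF', hy⟩ := hy
        have hmono : ∀ {F F' : Submodule O H}, F ≤ F' →
            LinearMap.range (F.subtype.rTensor H) ≤ LinearMap.range (F'.subtype.rTensor H) := by
          intro F F' h
          rw [← Submodule.subtype_comp_inclusion F F' h, LinearMap.rTensor_comp]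
          exact LinearMap.range_comp_le_range _ _
        exact ⟨F ⊔ F', hF.sup hF', add_mem (hmono le_sup_left hx) (hmono le_sup_right hy)⟩
    choose F hF hF' using fun x : H => h1 (Coalgebra.comul (R := O) x)
    refine ⟨⨆ x ∈ s, F x, Submodule.fg_biSup s F fun x _ => hF x, fun x hx => ?_⟩
    have h2 : Submodule.span O (s : Set H) ≤ (LinearMap.range
        ((⨆ x ∈ s, F x).subtype.rTensor H)).comap (Coalgebra.comul (R := O) (A := H)) := by
      refine Submodule.span_le.2 fun x hx => ?_
      have hle : F x ≤ ⨆ x ∈ s, F x := le_biSup F hx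
      have h3 := hF' x
      rw [← Submodule.subtype_comp_inclusion _ _ hle, LinearMap.rTensor_comp] at h3
      exact LinearMap.range_comp_le_range _ _ h3
    exact h2 hx
  -- The kernel `M` of `q` consists of the `x` whose comultiplication lies in `F ⊗ H`. It is the
  -- largest subcomodule inside `F`, and it contains `N` by the choice of `F`.
  set q : H →ₗ[O] (H ⧸ F) ⊗[O] H := F.mkQ.rTensor H ∘ₗ Coalgebra.comul (R := O) (A := H) with hq
  set M := LinearMap.ker q with hM
  have hexF : Function.Exact (F.subtype.rTensor H) (F.mkQ.rTensor H) :=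
    Module.Flat.rTensor_exact H (LinearMap.exact_subtype_mkQ F)
  have hNM : N ≤ M := fun x hx => (hexF _).2 (hNF x hx)
  -- Apply the counit to the second factor: `x = (1 ⊗ ε)(Δ x)` lies in `F` once `Δ x` lies in `F ⊗
  -- H`.
  have hMF : M ≤ F := by
    intro x hx
    obtain ⟨y, hy⟩ := (hexF _).1 hx
    have h1 : ∀ y : F ⊗[O] H, TensorProduct.rid O H ((Coalgebra.counit (R := O) (A := H)).lTensor H
        (F.subtype.rTensor H y)) ∈ F := by
      intro y
      induction y with
      | zero => simp
      | add x y hx hy => rw [map_add, map_add, map_add]; exact add_mem hx hy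
      | tmul a b => exact F.smul_mem _ a.2
    have h2 := h1 y
    rwa [hy, Coalgebra.lTensor_counit_comul, TensorProduct.rid_tmul, one_smul] at h2
  have : IsNoetherian O F := isNoetherian_of_fg_of_noetherian F hF
  have hMfg : M.FG := by
    have h1 := (IsNoetherian.noetherian (M.comap F.subtype)).map F.subtype
    rwa [Submodule.map_comap_subtype, inf_eq_right.2 hMF] at h1
  have : Module.Finite O M := Module.Finite.iff_fg.2 hMfg
  -- Flat modules over a domain are torsion-free, and finitely generated torsion-free modules over a
  -- principal ideal domain are free.
  have : Module.IsTorsionFree O H := inferInstance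
  have : Module.Free O M := inferInstance
  -- By flatness `M ⊗ H` is the kernel of `q ⊗ H`. Coassociativity then gives stability of `M`: up
  -- to reassociation, `(q ⊗ 1)(Δ x)` is `(1 ⊗ Δ)(q x) = 0`.
  have hexM : Function.Exact (M.subtype.rTensor H) (q.rTensor H) :=
    Module.Flat.rTensor_exact H (LinearMap.exact_subtype_ker_map q)
  have hcomul : ∀ x : M, Coalgebra.comul (R := O) (x : H) ∈
      LinearMap.range (M.subtype.rTensor H) := by
    intro x
    refine (hexM _).1 ?_
    have h1 : ∀ z : (H ⊗[O] H) ⊗[O] H, TensorProduct.assoc O (H ⧸ F) H H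
        ((F.mkQ.rTensor H).rTensor H z) =
          F.mkQ.rTensor (H ⊗[O] H) (TensorProduct.assoc O H H H z) := by
      intro z
      refine LinearMap.congr_fun (f := (TensorProduct.assoc O (H ⧸ F) H H).toLinearMap ∘ₗ
        (F.mkQ.rTensor H).rTensor H) (g := F.mkQ.rTensor (H ⊗[O] H) ∘ₗ
          (TensorProduct.assoc O H H H).toLinearMap) ?_ z
      ext a b c
      rfl
    refine (TensorProduct.assoc O (H ⧸ F) H H).injective ?_
    have h2 := LinearMap.congr_fun (Coalgebra.coassoc (R := O) (A := H)) (x : H)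
    simp only [LinearMap.comp_apply, LinearEquiv.coe_coe] at h2
    rw [hq, LinearMap.rTensor_comp, LinearMap.comp_apply, h1, h2, map_zero,
      ← LinearMap.comp_apply, LinearMap.rTensor_comp_lTensor, ← LinearMap.lTensor_comp_rTensor,
      LinearMap.comp_apply]
    have h3 : F.mkQ.rTensor H (Coalgebra.comul (R := O) (x : H)) = 0 := x.2
    rw [h3, map_zero]
  -- The carrier of a representation must live in the universe of `O`, so `M`, which lives in the
  -- universe of `H`, is replaced by a power of `O`.
  let e : (Fin (Module.finrank O M) → O) ≃ₗ[O] M := (Module.finBasis O M).equivFun.symm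
  set j : (Fin (Module.finrank O M) → O) →ₗ[O] H := M.subtype ∘ₗ e.toLinearMap with hj
  have hinj : Function.Injective j := M.injective_subtype.comp e.injective
  have hjr : LinearMap.range j = M := by
    rw [hj, LinearMap.range_comp_of_range_eq_top _ e.range, Submodule.range_subtype]
  obtain ⟨U, i, hi⟩ := exists_coact_of_injective j hinj fun x => by
    obtain ⟨y, hy⟩ := hcomul (e x)
    refine ⟨e.symm.toLinearMap.rTensor H y, ?_⟩
    rw [← LinearMap.comp_apply, ← LinearMap.rTensor_comp, hj, LinearMap.comp_assoc,
      LinearEquiv.comp_symm, LinearMap.comp_id, hy]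
    rfl
  exact ⟨U, i, hi.1, hi.2.1, hi.2.2.trans hjr ▸ hNM⟩

end FreeRep

end Coefficients

/-! ### Tannakian reconstruction of a point from a tensor endomorphism. -/

section Reconstruction

universe u v

variable {O : Type u} {H : Type v} [CommRing O] [CommRing H] [HopfAlgebra O H]
  {W : Type*} [CommRing W] [Algebra O W] {S : Type*} [CommRing S] [Algebra W S]

namespace FreeRep

/-- This dictates the reconstruction: a point acting as `lam` must take at the coefficient of `(l,
v)` the value `l (lam v)`. -/
theorem canonForm_act (V : FreeRep O H) (l : V.carrier →ₗ[O] O) (h : Points W (W ⊗[O] H) S)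
    (v : V.carrier) :
    canonForm W S l (V.act h (1 ⊗ₜ (1 ⊗ₜ v))) = h.hom (1 ⊗ₜ V.matrixCoeff l v) := by
  rw [act_tmul, canonForm_evalCoeff]
  rfl

/-- With `matrixCoeff_tensor`, this turns compatibility with tensor products into multiplicativity
of the reconstructed point. -/
theorem canonForm_canonTensor (V U : FreeRep O H) (l : V.carrier →ₗ[O] O)
    (l' : U.carrier →ₗ[O] O) (x : V.Canon W S) (y : U.Canon W S) :
    canonForm W S (V := V.carrier ⊗[O] U.carrier) (LinearMap.mul' O O ∘ₗ TensorProduct.map l l')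
      (canonTensor W S V U (x ⊗ₜ y)) = canonForm W S l x * canonForm W S l' y := by
  set L := canonForm W S (V := V.carrier ⊗[O] U.carrier)
    (LinearMap.mul' O O ∘ₗ TensorProduct.map l l') with hL
  refine LinearMap.congr_fun (f := L ∘ₗ (canonTensor W S V U).toLinearMap ∘ₗ
    (TensorProduct.mk S _ _).flip y) (g := (LinearMap.mulRight S (canonForm W S l' y)) ∘ₗ
      canonForm W S l) (canon_ext fun v => ?_) x
  refine LinearMap.congr_fun (f := L ∘ₗ (canonTensor W S V U).toLinearMap ∘ₗ
    TensorProduct.mk S _ _ (1 ⊗ₜ (1 ⊗ₜ v)))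
      (g := (LinearMap.mulLeft S (canonForm W S l (1 ⊗ₜ (1 ⊗ₜ v)))) ∘ₗ
        canonForm W S l') (canon_ext fun u => ?_) y
  change L (canonTensor W S V U ((1 ⊗ₜ (1 ⊗ₜ v)) ⊗ₜ (1 ⊗ₜ (1 ⊗ₜ u)))) =
    canonForm W S l (1 ⊗ₜ (1 ⊗ₜ v)) * canonForm W S l' (1 ⊗ₜ (1 ⊗ₜ u))
  rw [canonTensor_tmul, mul_one, baseTensor_tmul, mul_one, canonForm_one_tmul, canonForm_one_tmul,
    hL]
  refine (canonForm_one_tmul (V := V.carrier ⊗[O] U.carrier) _ _ _).trans ?_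
  simp

theorem matrixCoeff_tensor (V U : FreeRep O H) (l : V.carrier →ₗ[O] O)
    (l' : U.carrier →ₗ[O] O) (v : V.carrier) (u : U.carrier) :
    (V.tensor U).matrixCoeff (LinearMap.mul' O O ∘ₗ TensorProduct.map l l')
      (v ⊗ₜ[O] u : V.carrier ⊗[O] U.carrier) = V.matrixCoeff l v * U.matrixCoeff l' u := by
  have h : ∀ (y : V.carrier ⊗[O] H) (z : U.carrier ⊗[O] H), TensorProduct.lid O H
      ((LinearMap.mul' O O ∘ₗ TensorProduct.map l l').rTensor H
        (mulCoact O V.carrier U.carrier H (y ⊗ₜ z))) =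
      TensorProduct.lid O H (l.rTensor H y) * TensorProduct.lid O H (l'.rTensor H z) := by
    intro y z
    induction y with
    | zero => simp
    | add x y hx hy => simp only [TensorProduct.add_tmul, map_add, hx, hy, add_mul]
    | tmul v a =>
      induction z with
      | zero => simp
      | add x y hx hy => simp only [TensorProduct.tmul_add, map_add, hx, hy, mul_add]
      | tmul u b =>
        rw [mulCoact_tmul]
        change (l v * l' u) • (a * b) = (l v • a) * (l' u • b)
        rw [smul_mul_smul_comm]
  exact h _ _

theorem matrixCoeff_unit : (unit O H).matrixCoeff (LinearMap.id : O →ₗ[O] O) (1 : O) = 1 := by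
  change (TensorProduct.lid O H) ((LinearMap.id : O →ₗ[O] O).rTensor H ((1 : O) ⊗ₜ (1 : H))) = 1
  simp

end FreeRep

open FreeRep

variable [IsDomain O] [IsPrincipalIdealRing O] [Module.Flat O H]

/-- Take a finite free subrepresentation of `H` containing both functions, with the restricted
counit as the form. Having both in one `V` with one `l` is what additivity needs later. -/
theorem exists_matrixCoeff_eq (a a' : H) : ∃ (V : FreeRep O H) (l : V.carrier →ₗ[O] O)
    (v v' : V.carrier), V.matrixCoeff l v = a ∧ V.matrixCoeff l v' = a' := by
  obtain ⟨U, j, hj, -, hU⟩ := exists_isCoordMap (O := O) (Submodule.span O {a, a'})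
    (Submodule.fg_span (Set.toFinite _))
  obtain ⟨v, hv⟩ := hU (Submodule.subset_span (Set.mem_insert a {a'}))
  obtain ⟨v', hv'⟩ := hU (Submodule.subset_span (Set.mem_insert_of_mem a rfl))
  exact ⟨U, _, v, v', by rw [hj.matrixCoeff_eq, hv], by rw [hj.matrixCoeff_eq, hv']⟩

/-- A point is determined by its actions on all representations. -/
theorem points_ext_act {g h : Points W (W ⊗[O] H) S} (H' : ∀ V : FreeRep O H, V.act g = V.act h) :
    g = h := by
  refine Points.ext (AlgHom.toLinearMap_injective (base_ext fun a => ?_))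
  obtain ⟨V, l, v, -, rfl, -⟩ := exists_matrixCoeff_eq (O := O) a a
  change g.hom _ = h.hom _
  rw [← canonForm_act, ← canonForm_act, H']

section

variable {lam : ∀ V : FreeRep O H, V.Canon W S →ₗ[S] V.Canon W S}

/-- Some finite free `U` inside `H` contains the images of both coefficient maps, so both
representations map equivariantly to `U`. Both vectors then go to the same `u` and both forms are
pulled back from the counit on `U`; naturality equates the two scalars. -/
theorem canonForm_natural_eq
    (natural : ∀ (V U : FreeRep O H) (f : V.carrier →ₗ[O] U.carrier), IsHom V U f →
      ∀ x : V.Canon W S, lam U (canonMap W S f x) = canonMap W S f (lam V x))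
    {V V' : FreeRep O H} {l : V.carrier →ₗ[O] O}
    {l' : V'.carrier →ₗ[O] O} {v : V.carrier} {v' : V'.carrier}
    (h : V.matrixCoeff l v = V'.matrixCoeff l' v') :
    canonForm W S l (lam V (1 ⊗ₜ (1 ⊗ₜ v))) = canonForm W S l' (lam V' (1 ⊗ₜ (1 ⊗ₜ v'))) := by
  obtain ⟨U, j, hj, hinj, hU⟩ := exists_isCoordMap (O := O)
    (LinearMap.range (V.matrixCoeff l) ⊔ LinearMap.range (V'.matrixCoeff l'))
    (Submodule.FG.sup (Module.Finite.iff_fg.1 inferInstance)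
      (Module.Finite.iff_fg.1 inferInstance))
  have key : ∀ {V : FreeRep O H} (l : V.carrier →ₗ[O] O) (v : V.carrier) (u : U.carrier),
      LinearMap.range (V.matrixCoeff l) ≤ LinearMap.range j → j u = V.matrixCoeff l v →
      canonForm W S l (lam V (1 ⊗ₜ (1 ⊗ₜ v))) =
        canonForm W S (Coalgebra.counit (R := O) (A := H) ∘ₗ j) (lam U (1 ⊗ₜ (1 ⊗ₜ u))) := by
    intro V l v u hr hu
    obtain ⟨g, hg, hjg⟩ := (V.isCoordMap_matrixCoeff l).exists_factor hj hinj hr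
    have hgu : u = g v := hinj (hu.trans (LinearMap.congr_fun hjg v).symm)
    have h1 := natural V U g hg (1 ⊗ₜ (1 ⊗ₜ v))
    rw [hgu]
    refine Eq.trans ?_ (congrArg (canonForm W S (Coalgebra.counit (R := O) (A := H) ∘ₗ j)) h1).symm
    rw [canonMap, canonForm_baseChange, LinearMap.comp_assoc, hjg, counit_matrixCoeff]
  obtain ⟨u, hu⟩ := hU (Submodule.mem_sup_left ⟨v, rfl⟩)
  rw [key l v u (le_sup_left.trans hU) hu, key l' v' u (le_sup_right.trans hU) (hu.trans h)]

/-- Tannakian reconstruction: every endomorphism of the fiber functor `V ↦ S ⊗ V_W` that is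
compatible with tensor products and the unit object is given by a point. -/
theorem exists_point_act
    (natural : ∀ (V U : FreeRep O H) (f : V.carrier →ₗ[O] U.carrier), IsHom V U f →
      ∀ x : V.Canon W S, lam U (canonMap W S f x) = canonMap W S f (lam V x))
    (tensor : ∀ (V U : FreeRep O H) (x : V.Canon W S) (y : U.Canon W S),
      lam (V.tensor U) (canonTensor W S V U (x ⊗ₜ y)) =
        canonTensor W S V U (lam V x ⊗ₜ lam U y))
    (unit : ∀ x : (FreeRep.unit O H).Canon W S, lam (FreeRep.unit O H) x = x) :
    ∃ h : Points W (W ⊗[O] H) S, ∀ V, lam V = V.act h := by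
  -- The composite structure `O → W → S` allows the map on `H` to be `O`-linear and to extend to `W
  -- ⊗ H`.
  let _ : Algebra O S := ((algebraMap W S).comp (algebraMap O W)).toAlgebra
  have _ : IsScalarTower O W S := .of_algebraMap_eq fun _ => rfl
  -- The scalar depends on the coefficient `a` alone, so a choice of `s` defines a function `φ` on
  -- `H`.
  have hex : ∀ a : H, ∃ s : S, ∀ (V : FreeRep O H) (l : V.carrier →ₗ[O] O) (v : V.carrier),
      V.matrixCoeff l v = a → canonForm W S l (lam V (1 ⊗ₜ (1 ⊗ₜ v))) = s := by
    intro a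
    obtain ⟨V, l, v, -, rfl, -⟩ := exists_matrixCoeff_eq (O := O) a a
    exact ⟨_, fun V' l' v' h => canonForm_natural_eq natural h⟩
  choose φ hφ using hex
  have hadd : ∀ a a', φ (a + a') = φ a + φ a' := by
    intro a a'
    obtain ⟨V, l, v, v', h, h'⟩ := exists_matrixCoeff_eq (O := O) a a'
    rw [← hφ a V l v h, ← hφ a' V l v' h', ← hφ (a + a') V l (v + v') (by rw [map_add, h, h'])]
    simp only [TensorProduct.tmul_add, map_add]
  have hsmul : ∀ (r : O) (a : H), φ (r • a) = r • φ a := by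
    intro r a
    obtain ⟨V, l, v, -, h, -⟩ := exists_matrixCoeff_eq (O := O) a a
    rw [← hφ a V l v h, ← hφ (r • a) V l (r • v) (by rw [map_smul, h]), TensorProduct.tmul_smul,
      ← algebraMap_smul W r, TensorProduct.tmul_smul, ← algebraMap_smul S (algebraMap O W r),
      map_smul, map_smul]
    rfl
  have hone : φ 1 = 1 := by
    rw [← hφ 1 (FreeRep.unit O H) LinearMap.id (1 : O) matrixCoeff_unit, unit]
    refine (canonForm_one_tmul (V := O) _ _ _).trans ?_
    change (1 : S) * algebraMap W S (algebraMap O W 1) = 1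
    rw [map_one, map_one, one_mul]
  have hmul : ∀ a a', φ (a * a') = φ a * φ a' := by
    intro a a'
    obtain ⟨V, l, v, v', h, h'⟩ := exists_matrixCoeff_eq (O := O) a a'
    -- The product `a * a'` is the coefficient of `v ⊗ v'` in `V ⊗ V` for the form `l ⊗ l`.
    rw [← hφ a V l v h, ← hφ a' V l v' h', ← canonForm_canonTensor, ← tensor,
      ← hφ (a * a') (V.tensor V) _ _ ((matrixCoeff_tensor V V l l v v').trans (by rw [h, h'])),
      canonTensor_tmul, mul_one, baseTensor_tmul, mul_one]
    rfl
  let ψ : H →ₐ[O] S := AlgHom.ofLinearMap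
    { toFun := φ, map_add' := hadd, map_smul' := hsmul } hone hmul
  refine ⟨Points.mk (Algebra.TensorProduct.lift (Algebra.ofId W S) ψ fun _ _ => .all ..),
    fun V => canon_ext fun v => canon_ext_form fun l => ?_⟩
  -- Vectors of `S ⊗ V_W` are separated by the forms coming from `V`, so comparing coefficients
  -- suffices; they agree by the definition of `φ`.
  rw [canonForm_act, hφ _ V l v rfl]
  change _ = algebraMap W S 1 * φ _
  rw [map_one, one_mul]

end

end Reconstruction

/-! ### Weight decomposition, and gradings as coactions. -/

section Grading

universe u v

open LaurentPolynomial

variable {O : Type u} {H : Type v} [CommRing O] [CommRing H] [HopfAlgebra O H]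
  {W : Type*} [CommRing W] [Algebra O W] (μ : (W ⊗[O] H) →ₐc[W] W[T;T⁻¹])
  {B : Type*} [CommRing B] [Algebra W B]

variable (W B) in
/-- The coefficient of `T ^ n` of a Laurent polynomial, as a linear map. -/
def laurentCoeff (n : ℤ) : B[T;T⁻¹] →ₗ[W] B where
  toFun F := F.coeff n
  map_add' _ _ := rfl
  map_smul' _ _ := rfl

theorem laurentCoeff_C_mul_T (a : B) (m n : ℤ) :
    laurentCoeff W B n (C a * T m) = if m = n then a else 0 :=
  coeff_C_mul_T a m n

theorem laurent_tensor_induction {M : Type*} [AddCommGroup M] [Module W M]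
    {P : B[T;T⁻¹] ⊗[W] M → Prop} (zero : P 0) (add : ∀ x y, P x → P y → P (x + y))
    (tmul : ∀ (b : B) (n : ℤ) (m : M), P ((C b * T n) ⊗ₜ m)) (x : B[T;T⁻¹] ⊗[W] M) : P x := by
  induction x with
  | zero => exact zero
  | add x y hx hy => exact add x y hx hy
  | tmul F m =>
    induction F using LaurentPolynomial.induction_on' with
    | add F G hF hG => rw [TensorProduct.add_tmul]; exact add _ _ hF hG
    | C_mul_T n b => exact tmul b n m

theorem map_evalUnit_unitT (u : Bˣ) :
    Units.map (Points.evalUnit (W := W) u : W[T;T⁻¹] →* B) (unitT W) = u := by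
  refine Units.ext ?_
  change Points.evalUnit (W := W) u (T 1) = u
  rw [Points.evalUnit_T, zpow_one]

theorem evalUnit_C_mul_T (u : Bˣ) (a : W) (n : ℤ) :
    Points.evalUnit (W := W) u (C a * T n) = a • ((u ^ n : Bˣ) : B) := by
  rw [map_mul, Points.evalUnit_T, C_eq_algebraMap, AlgHom.commutes, Algebra.smul_def]

namespace FreeRep

/-- The universal unit `T` specializes to every unit `u`; so the weight condition, imposed for `T`
only, holds for all units. -/
theorem transfer_act_cochar (V : FreeRep O H) (u : Bˣ) (v : V.Base W) :
    transfer (V.Base W) (Points.evalUnit u)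
      (V.act (Points.cochar μ (unitT W)) ((1 : W[T;T⁻¹]) ⊗ₜ v)) =
      V.act (Points.cochar μ u) ((1 : B) ⊗ₜ v) := by
  rw [transfer_act, Points.map_cochar, map_evalUnit_unitT, transfer_tmul, map_one]

theorem act_cochar_of_mem_weight {V : FreeRep O H} {i : ℤ} {v : V.Base W} (hv : v ∈ V.weight μ i)
    (u : Bˣ) : V.act (Points.cochar μ u) ((1 : B) ⊗ₜ v) = ((u ^ i : Bˣ) : B) ⊗ₜ v := by
  rw [← transfer_act_cochar, (V.mem_weight μ i v).1 hv, transfer_tmul, Points.evalUnit_T]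

/-- The coefficient of `T ^ n` of an element of `W[T;T⁻¹] ⊗ M`. -/
def weightCoeff (M : Type*) [AddCommGroup M] [Module W M] (n : ℤ) : W[T;T⁻¹] ⊗[W] M →ₗ[W] M :=
  (TensorProduct.lid W M).toLinearMap ∘ₗ (laurentCoeff W W n).rTensor M

theorem weightCoeff_tmul {M : Type*} [AddCommGroup M] [Module W M] (n m : ℤ) (a : W) (x : M) :
    weightCoeff M n ((C a * T m) ⊗ₜ x) = if m = n then a • x else 0 := by
  change laurentCoeff W W n (C a * T m) • x = _
  rw [laurentCoeff_C_mul_T, ite_smul, zero_smul]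

/-- Write `ρ(μ(U)) v = ∑ U ^ n ⊗ v_n`. Comparing the coefficients of `U ^ n` in `ρ(μ(T)) ρ(μ(U)) v =
ρ(μ(TU)) v` gives `ρ(μ(T)) v_n = T ^ n ⊗ v_n`. -/
theorem weightCoeff_mem (V : FreeRep O H) (n : ℤ) (v : V.Base W) :
    weightCoeff (V.Base W) n (V.act (Points.cochar μ (unitT W)) ((1 : W[T;T⁻¹]) ⊗ₜ v)) ∈
      V.weight μ n := by
  set F := V.act (Points.cochar μ (unitT W)) ((1 : W[T;T⁻¹]) ⊗ₜ v) with hF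
  let D := W[T;T⁻¹]
  -- In `D[T;T⁻¹]` the unit `t` is the inner variable `T` of `D`, and `unitT D` is the outer
  -- variable `U`.
  let t : D[T;T⁻¹]ˣ := Units.map (constHom W D : D →* D[T;T⁻¹]) (unitT W)
  -- Coefficient of `U ^ n` after `ρ(μ(T))`: the action has constant coefficients in `U`, so it
  -- passes to `v_n`.
  have h1 : ∀ F : D ⊗[W] V.Base W, (laurentCoeff W D n).rTensor (V.Base W)
      (V.act (Points.cochar μ t) (transfer (V.Base W) (Points.evalUnit (unitT D)) F)) =
      V.act (Points.cochar μ (unitT W)) ((1 : D) ⊗ₜ weightCoeff (V.Base W) n F) := by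
    intro F
    induction F using laurent_tensor_induction with
    | zero => simp
    | add x y hx hy => simp only [map_add, hx, hy, TensorProduct.tmul_add]
    | tmul a m x =>
      have h2 : ∀ (y : D ⊗[W] V.Base W), (laurentCoeff W D n).rTensor (V.Base W)
          ((T m : D[T;T⁻¹]) • transfer (V.Base W) (constHom W D) y) = if m = n then y else 0 := by
        intro y
        induction y with
        | zero => simp
        | add x y hx hy =>
          simp only [map_add, smul_add, hx, hy]
          split_ifs <;> simp
        | tmul b x =>
          rw [transfer_tmul, TensorProduct.smul_tmul', LinearMap.rTensor_tmul, smul_eq_mul,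
            mul_comm, constHom_apply, laurentCoeff_C_mul_T]
          split_ifs <;> simp
      have h3 : transfer (V.Base W) (Points.evalUnit (unitT D)) ((C a * T m) ⊗ₜ x) =
          (T m : D[T;T⁻¹]) • transfer (V.Base W) (constHom W D) ((1 : D) ⊗ₜ (a • x)) := by
        rw [transfer_tmul, transfer_tmul, evalUnit_C_mul_T, unitT_zpow, map_one,
          TensorProduct.smul_tmul', smul_eq_mul, mul_one, TensorProduct.smul_tmul]
      rw [h3, map_smul, ← Points.map_cochar, ← transfer_act, h2, weightCoeff_tmul]
      split_ifs <;> simp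
  -- Coefficient of `U ^ n` after the substitution `U ↦ TU`: this multiplies `v_n` by `T ^ n`.
  have h4 : ∀ F : D ⊗[W] V.Base W, (laurentCoeff W D n).rTensor (V.Base W)
      (transfer (V.Base W) (Points.evalUnit (t * unitT D)) F) =
      (T n : D) ⊗ₜ weightCoeff (V.Base W) n F := by
    intro F
    induction F using laurent_tensor_induction with
    | zero => simp
    | add x y hx hy => simp only [map_add, hx, hy, TensorProduct.tmul_add]
    | tmul a m x =>
      have hz : (t * unitT D) ^ m = t ^ m * unitT D ^ m :=
        (show Commute t (unitT D) from Units.ext (mul_comm _ _)).mul_zpow m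
      have ht : ((t ^ m : D[T;T⁻¹]ˣ) : D[T;T⁻¹]) = C (T m) := by
        rw [← map_zpow, ← unitT_zpow m]
        rfl
      rw [transfer_tmul, evalUnit_C_mul_T, hz, Units.val_mul, unitT_zpow, ht,
        TensorProduct.smul_tmul, LinearMap.rTensor_tmul, laurentCoeff_C_mul_T, weightCoeff_tmul]
      split_ifs with h
      · rw [h]
      · simp
  rw [mem_weight, ← h1, ← h4, hF, transfer_act_cochar, transfer_act_cochar, map_mul, act_mul]
  rfl

theorem iSup_weight (V : FreeRep O H) : ⨆ n, V.weight μ n = ⊤ := by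
  refine eq_top_iff.2 fun v _ => ?_
  -- Setting `T = 1` adds up the coefficients, and `μ(1)` acts trivially, so `v` is the sum of its
  -- weight components. Allowing every larger finite set `s'` makes the statement stable under
  -- addition.
  have h1 : ∀ F : W[T;T⁻¹] ⊗[W] V.Base W, ∃ s : Finset ℤ, ∀ s', s ⊆ s' →
      TensorProduct.lid W (V.Base W) (transfer (V.Base W) (Points.evalUnit 1) F) =
        ∑ n ∈ s', weightCoeff (V.Base W) n F := by
    intro F
    induction F using laurent_tensor_induction with
    | zero => exact ⟨∅, fun s' _ => by simp⟩
    | add x y hx hy =>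
      obtain ⟨s, hs⟩ := hx
      obtain ⟨t, ht⟩ := hy
      refine ⟨s ∪ t, fun s' h => ?_⟩
      simp only [map_add, Finset.sum_add_distrib]
      rw [hs s' (Finset.subset_union_left.trans h), ht s' (Finset.subset_union_right.trans h)]
    | tmul a m x =>
      refine ⟨{m}, fun s' h => ?_⟩
      simp only [weightCoeff_tmul, transfer_tmul]
      rw [evalUnit_C_mul_T, one_zpow, Units.val_one, TensorProduct.lid_tmul, smul_eq_mul, mul_one,
        Finset.sum_ite_eq, if_pos (h (Finset.mem_singleton_self m))]
  obtain ⟨s, hs⟩ := h1 (V.act (Points.cochar μ (unitT W)) ((1 : W[T;T⁻¹]) ⊗ₜ v))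
  have h2 := hs s subset_rfl
  rw [transfer_act_cochar, map_one, act_one, LinearMap.id_apply, TensorProduct.lid_tmul,
    one_smul] at h2
  rw [h2]
  exact Submodule.sum_mem _ fun n _ => Submodule.mem_iSup_of_mem n (weightCoeff_mem μ V n v)

variable {S : Type*} [CommRing S] [Algebra W S] (𝒮 : ℤ → Submodule W S)

section

variable [GradedAlgebra 𝒮]

/-- The coaction `S ⊗ V_W → S[T;T⁻¹] ⊗ V_W` that corresponds to the grading of `S ⊗ V_W`. -/
def canonCoact (V : FreeRep O H) : V.Canon W S →ₗ[W] V.Canon W S[T;T⁻¹] :=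
  (V.act (Points.cochar μ (unitT S))).restrictScalars W ∘ₗ transfer (V.Base W) (gradCoact 𝒮)

theorem canonCoact_apply (V : FreeRep O H) (x : V.Canon W S) :
    V.canonCoact μ 𝒮 x =
      V.act (Points.cochar μ (unitT S)) (transfer (V.Base W) (gradCoact 𝒮) x) := rfl

theorem canonCoact_tmul {V : FreeRep O H} {m i : ℤ} {s : S} (hs : s ∈ 𝒮 m) {v : V.Base W}
    (hv : v ∈ V.weight μ i) :
    V.canonCoact μ 𝒮 (s ⊗ₜ v) = (C s * T (m + i) : S[T;T⁻¹]) ⊗ₜ v := by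
  rw [canonCoact_apply, transfer_tmul, gradCoact_of_mem 𝒮 hs,
    ← mul_one (C s * T m), ← smul_eq_mul, ← TensorProduct.smul_tmul', map_smul,
    act_cochar_of_mem_weight μ hv, unitT_zpow, TensorProduct.smul_tmul', smul_eq_mul, T_add,
    mul_assoc]

/-- With its converse `mem_of_canonCoact`, this describes the degree `l` piece as the `T ^
l`-eigenspace of the coaction. On a generator, `s` contributes `T ^ (l - i)` and `v` contributes `T
^ i`. -/
theorem canonCoact_of_mem {V : FreeRep O H} {l : ℤ} {x : V.Canon W S}
    (hx : x ∈ V.canonDeg μ 𝒮 l) :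
    V.canonCoact μ 𝒮 x = (T l : S[T;T⁻¹]) • transfer (V.Base W) (constHom W S) x := by
  induction hx using Submodule.span_induction with
  | mem x hx =>
    obtain ⟨i, s, hs, v, hv, rfl⟩ := hx
    rw [canonCoact_tmul μ 𝒮 hs hv, transfer_tmul, TensorProduct.smul_tmul', sub_add_cancel,
      smul_eq_mul, mul_comm]
    rfl
  | zero => simp
  | add x y _ _ hx hy => rw [map_add, map_add, hx, hy, smul_add]
  | smul w x _ hx => rw [map_smul, map_smul, hx, smul_comm]

theorem canon_induction {V : FreeRep O H} {P : V.Canon W S → Prop} (zero : P 0)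
    (add : ∀ x y, P x → P y → P (x + y))
    (tmul : ∀ (m i : ℤ) (s : S) (v : V.Base W), s ∈ 𝒮 m → v ∈ V.weight μ i → P (s ⊗ₜ v))
    (x : V.Canon W S) : P x := by
  induction x using TensorProduct.induction_on with
  | zero => exact zero
  | add x y hx hy => exact add x y hx hy
  | tmul s v =>
    have hv : v ∈ ⨆ n, V.weight μ n := by rw [iSup_weight]; trivial
    induction hv using Submodule.iSup_induction' with
    | zero => rw [TensorProduct.tmul_zero]; exact zero
    | add v v' _ _ hv hv' => rw [TensorProduct.tmul_add]; exact add _ _ hv hv'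
    | mem i v hv =>
      induction s using DirectSum.Decomposition.inductionOn 𝒮 with
      | zero => rw [TensorProduct.zero_tmul]; exact zero
      | homogeneous s => exact tmul _ i s v s.2 hv
      | add s s' hs hs' => rw [TensorProduct.add_tmul]; exact add _ _ hs hs'

/-- The coefficient of `T ^ l` in a coaction always has degree `l`, as seen on homogeneous tensors;
under the hypothesis that coefficient is `x`. -/
theorem mem_of_canonCoact {V : FreeRep O H} {l : ℤ} {x : V.Canon W S}
    (hx : V.canonCoact μ 𝒮 x = (T l : S[T;T⁻¹]) • transfer (V.Base W) (constHom W S) x) :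
    x ∈ V.canonDeg μ 𝒮 l := by
  have h1 : ∀ x : V.Canon W S, (laurentCoeff W S l).rTensor (V.Base W) (V.canonCoact μ 𝒮 x) ∈
      V.canonDeg μ 𝒮 l := by
    intro x
    induction x using canon_induction μ 𝒮 with
    | zero => simp
    | add x y hx hy => rw [map_add, map_add]; exact add_mem hx hy
    | tmul m i s v hs hv =>
      rw [canonCoact_tmul μ 𝒮 hs hv, LinearMap.rTensor_tmul, laurentCoeff_C_mul_T]
      split_ifs with h
      · exact Submodule.subset_span ⟨i, s, by rwa [← h, add_sub_cancel_right], v, hv, rfl⟩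
      · rw [TensorProduct.zero_tmul]; exact zero_mem _
  have h2 : ∀ x : V.Canon W S, (laurentCoeff W S l).rTensor (V.Base W)
      ((T l : S[T;T⁻¹]) • transfer (V.Base W) (constHom W S) x) = x := by
    intro x
    induction x using TensorProduct.induction_on with
    | zero => simp
    | add x y hx hy => simp only [map_add, smul_add, hx, hy]
    | tmul b x =>
      rw [transfer_tmul, TensorProduct.smul_tmul', LinearMap.rTensor_tmul, smul_eq_mul,
        mul_comm, constHom_apply, laurentCoeff_C_mul_T, if_pos rfl]
  have h3 := h1 x
  rwa [hx, h2] at h3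

theorem act_mem_canonDeg {h : Points W (W ⊗[O] H) S} (hh : h ∈ gradedPoints μ 𝒮)
    {V : FreeRep O H} {l : ℤ} {x : V.Canon W S} (hx : x ∈ V.canonDeg μ 𝒮 l) :
    V.act h x ∈ V.canonDeg μ 𝒮 l := by
  refine mem_of_canonCoact μ 𝒮 ?_
  -- Since the coaction of `S` turns `h` into `μ(T)⁻¹ h μ(T)`, the factor `μ(T)` in front cancels
  -- and leaves `h μ(T)`: the action of `h` commutes with the coaction.
  rw [canonCoact_apply, transfer_act, (preserves_iff μ 𝒮 h).1 hh, ← LinearMap.comp_apply,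
    ← act_mul, Points.conj, ← mul_assoc, mul_inv_cancel_left, act_mul, LinearMap.comp_apply,
    ← canonCoact_apply, canonCoact_of_mem μ 𝒮 hx, map_smul, ← transfer_act]

theorem act_mem_canonDeg_iff {h : Points W (W ⊗[O] H) S} (hh : h ∈ gradedPoints μ 𝒮)
    {V : FreeRep O H} {l : ℤ} {x : V.Canon W S} :
    V.act h x ∈ V.canonDeg μ 𝒮 l ↔ x ∈ V.canonDeg μ 𝒮 l := by
  refine ⟨fun hx => ?_, act_mem_canonDeg μ 𝒮 hh⟩
  have h1 := act_mem_canonDeg μ 𝒮 (inv_mem hh) hx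
  rwa [← LinearMap.comp_apply, ← act_mul, inv_mul_cancel, act_one] at h1

/-- The criterion is rewritten as an equality of `μ(T)` times the transformed `h` with `h * μ(T)`.
By faithfulness it may be tested on representations, hence on weight vectors `1 ⊗ v`. These are
homogeneous with homogeneous image, so both sides give `T ^ i` times the image. -/
theorem mem_gradedPoints_of_act [IsDomain O] [IsPrincipalIdealRing O] [Module.Flat O H]
    {h : Points W (W ⊗[O] H) S}
    (hh : ∀ (V : FreeRep O H) (l : ℤ), ∀ x ∈ V.canonDeg μ 𝒮 l, V.act h x ∈ V.canonDeg μ 𝒮 l) :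
    h ∈ gradedPoints μ 𝒮 := by
  refine (preserves_iff μ 𝒮 h).2 ?_
  rw [Points.conj, mul_assoc, eq_inv_mul_iff_mul_eq]
  refine points_ext_act fun V => LinearMap.ext fun y => ?_
  induction y with
  | zero => simp
  | add x y hx hy => rw [map_add, map_add, hx, hy]
  | tmul F v =>
    have hv : v ∈ ⨆ n, V.weight μ n := by rw [iSup_weight]; trivial
    induction hv using Submodule.iSup_induction' with
    | zero => simp
    | add v v' _ _ hv hv' => rw [TensorProduct.tmul_add, map_add, map_add, hv, hv']
    | mem i v hv =>
      have h1 : (1 : S) ⊗ₜ[W] v ∈ V.canonDeg μ 𝒮 i := Submodule.subset_span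
        ⟨i, 1, by rw [sub_self]; exact SetLike.one_mem_graded 𝒮, v, hv, rfl⟩
      have h2 : F ⊗ₜ[W] v = F • transfer (V.Base W) (gradCoact 𝒮) ((1 : S) ⊗ₜ[W] v) := by
        rw [transfer_tmul, map_one, TensorProduct.smul_tmul', smul_eq_mul, mul_one]
      rw [h2, map_smul, map_smul, act_mul, act_mul, LinearMap.comp_apply, LinearMap.comp_apply,
        ← transfer_act, ← canonCoact_apply, ← canonCoact_apply,
        canonCoact_of_mem μ 𝒮 h1, canonCoact_of_mem μ 𝒮 (hh V i _ h1), map_smul, transfer_act]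

theorem isTensorAut_actEquiv {h : Points W (W ⊗[O] H) S} (hh : h ∈ gradedPoints μ 𝒮) :
    IsTensorAut μ 𝒮 fun V : FreeRep O H => V.actEquiv h where
  graded _ _ _ := act_mem_canonDeg_iff μ 𝒮 hh
  natural _ _ _ hf x := act_canonMap hf h x
  tensor V U x y := act_canonTensor V U h x y
  unit x := act_unit h x

end

end FreeRep

open FreeRep

/-- The homomorphism `G(S)_μ → Aut^⊗` that sends `h` to the family of its actions. -/
def gradedPointsToAut {S : Type*} [CommRing S] [Algebra W S] (𝒮 : ℤ → Submodule W S)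
    [GradedAlgebra 𝒮] : gradedPoints μ 𝒮 →* tensorAut μ 𝒮 where
  toFun h := ⟨fun V => V.actEquiv h.1, isTensorAut_actEquiv μ 𝒮 h.2⟩
  map_one' := Subtype.ext (funext fun V => LinearEquiv.toLinearMap_injective (act_one V))
  map_mul' g h :=
    Subtype.ext (funext fun V => LinearEquiv.toLinearMap_injective (act_mul V g.1 h.1))

/-- Injectivity is joint faithfulness of the representations. Surjectivity is reconstruction, after
which the graded condition on the automorphism places the point in `gradedPoints`. -/
theorem gradedPointsToAut_bijective [IsDomain O] [IsPrincipalIdealRing O] [Module.Flat O H]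
    {S : Type*} [CommRing S] [Algebra W S] (𝒮 : ℤ → Submodule W S) [GradedAlgebra 𝒮] :
    Function.Bijective (gradedPointsToAut μ 𝒮) := by
  refine ⟨fun g h e => Subtype.ext (points_ext_act fun V => LinearMap.ext fun x => ?_),
    fun lam => ?_⟩
  · exact LinearEquiv.congr_fun (congrFun (congrArg Subtype.val e) V) x
  · obtain ⟨h, hh⟩ := exists_point_act (lam := fun V => (lam.1 V).toLinearMap) lam.2.natural
      lam.2.tensor lam.2.unit
    have hh' : ∀ V x, lam.1 V x = V.act h x := fun V x => LinearMap.congr_fun (hh V) x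
    refine ⟨⟨h, mem_gradedPoints_of_act μ 𝒮 fun V l x hx => ?_⟩,
      Subtype.ext (funext fun V => LinearEquiv.ext fun x => (hh' V x).symm)⟩
    rw [← hh']
    exact (lam.2.graded V l x).2 hx

end Grading

/-! ### Faithfully flat descent for rings and Witt vectors. -/

section Descent

variable {R : Type*} [CommRing R] {ι : Type*} {X : ι → Type*} [∀ i, CommRing (X i)]
  [∀ i, Algebra R (X i)]

/-- Tensor products commute with finite products in each variable, so an element is determined by
its components in `X i ⊗ X j`. -/
theorem pi_tensor_pi_ext [Finite ι] {x y : (∀ i, X i) ⊗[R] (∀ i, X i)}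
    (h : ∀ i j, TensorProduct.map (LinearMap.proj (R := R) (φ := X) i)
      (LinearMap.proj (R := R) (φ := X) j) x = TensorProduct.map (LinearMap.proj (R := R) (φ := X) i)
        (LinearMap.proj (R := R) (φ := X) j) y) : x = y := by
  have := Fintype.ofFinite ι
  classical
  refine (TensorProduct.piRight R R (∀ i, X i) X).injective (funext fun j => ?_)
  refine (TensorProduct.comm R (∀ i, X i) (X j)).injective ?_
  refine (TensorProduct.piRight R R (X j) X).injective (funext fun i => ?_)
  refine (TensorProduct.comm R (X j) (X i)).injective ?_
  have key : ∀ z : (∀ i, X i) ⊗[R] (∀ i, X i), TensorProduct.comm R (X j) (X i)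
      (TensorProduct.piRight R R (X j) X (TensorProduct.comm R (∀ i, X i) (X j)
        (TensorProduct.piRight R R (∀ i, X i) X z j)) i) =
      TensorProduct.map (LinearMap.proj (R := R) (φ := X) i)
        (LinearMap.proj (R := R) (φ := X) j) z := by
    intro z
    induction z with
    | zero => simp
    | add x y hx hy => simp only [map_add, Pi.add_apply, hx, hy]
    | tmul a b => simp
  rw [key, key, h]

variable (R X) in
/-- Descent along a faithfully flat family: compatible elements come from the base. -/
theorem exists_of_faithfullyFlat [Finite ι] [Module.FaithfullyFlat R (∀ i, X i)] (b : ∀ i, X i)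
    (h : ∀ i j, b i ⊗ₜ[R] (1 : X j) = (1 : X i) ⊗ₜ[R] b j) :
    ∃ r : R, ∀ i, algebraMap R (X i) r = b i := by
  -- Exactness of the start of the Amitsur complex for `R → ∏ X i`; the cocycle condition is then
  -- checked componentwise.
  have h1 := (Algebra.IsEffective.of_faithfullyFlat R (∀ i, X i)) b
  rw [Algebra.TensorProduct.includeLeftSubRight_apply, sub_eq_zero] at h1
  obtain ⟨r, hr⟩ := h1.1 (pi_tensor_pi_ext fun i j => by simpa using h i j)
  exact ⟨r, fun i => congrFun hr i⟩

variable (R X) in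
theorem eq_of_faithfullyFlat [Module.FaithfullyFlat R (∀ i, X i)] {r r' : R}
    (h : ∀ i, algebraMap R (X i) r = algebraMap R (X i) r') : r = r' :=
  FaithfulSMul.algebraMap_injective R (∀ i, X i) (funext h)

open WittVector

variable {p : ℕ} [hp : Fact p.Prime]

variable (R X) in
-- A Witt vector is its sequence of coefficients, and `WittVector.map` acts on each separately, so
-- gluing takes place coefficientwise in `R`.
theorem exists_wittVector_of_faithfullyFlat [Finite ι] [Module.FaithfullyFlat R (∀ i, X i)]
    (b : ∀ i, WittVector p (X i))
    (h : ∀ i j, WittVector.map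
      (Algebra.TensorProduct.includeLeft (R := R) (S := R) (A := X i) (B := X j)).toRingHom (b i) =
        WittVector.map
          (Algebra.TensorProduct.includeRight (R := R) (A := X i) (B := X j)).toRingHom (b j)) :
    ∃ r : WittVector p R, ∀ i, WittVector.map (algebraMap R (X i)) r = b i := by
  have hk : ∀ k, ∃ r : R, ∀ i, algebraMap R (X i) r = (b i).coeff k := fun k =>
    exists_of_faithfullyFlat R X (fun i => (b i).coeff k) fun i j => by
      have := congrArg (fun z => WittVector.coeff z k) (h i j)
      rwa [WittVector.map_coeff, WittVector.map_coeff] at this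
  choose r hr using hk
  refine ⟨WittVector.mk p r, fun i => WittVector.ext fun k => ?_⟩
  rw [WittVector.map_coeff, WittVector.coeff_mk, hr]

variable (R X) in
theorem wittVector_eq_of_faithfullyFlat [Module.FaithfullyFlat R (∀ i, X i)]
    {r r' : WittVector p R}
    (h : ∀ i, WittVector.map (algebraMap R (X i)) r = WittVector.map (algebraMap R (X i)) r') :
    r = r' := by
  refine WittVector.ext fun k => eq_of_faithfullyFlat R X fun i => ?_
  rw [← WittVector.map_coeff, h, WittVector.map_coeff]

/-- The homomorphism of pairs of Witt vectors induced by a ring homomorphism. -/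
abbrev wittPairMap (p : ℕ) [Fact p.Prime] {R R' : Type*} [CommRing R] [CommRing R']
    (φ : R →+* R') : WittVector p R × WittVector p R →+* WittVector p R' × WittVector p R' :=
  RingHom.prodMap (WittVector.map φ) (WittVector.map φ)

theorem wittPairMap_posElt {R R' : Type*} [CommRing R] [CommRing R'] (φ : R →+* R') (m : ℕ)
    (a : WittVector p R) :
    wittPairMap p φ (posElt p R m a) = posElt p R' m (WittVector.map φ a) := by
  simp [wittPairMap, posElt_apply]

theorem wittPairMap_negElt {R R' : Type*} [CommRing R] [CommRing R'] (φ : R →+* R') (m : ℕ)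
    (x : WittVector p R) :
    wittPairMap p φ (negElt p R m x) = negElt p R' m (WittVector.map φ x) := by
  simp [wittPairMap, negElt_apply, map_frobenius]

variable (R X) in
-- Each piece is a copy of the Witt vectors, parametrized compatibly with base change by the second
-- coordinate in positive degrees and by the first in the others. Gluing that coordinate is enough,
-- as it determines the other.
theorem exists_wittPiece_of_faithfullyFlat [Finite ι] [Module.FaithfullyFlat R (∀ i, X i)] (n : ℤ)
    (b : ∀ i, WittVector p (X i) × WittVector p (X i)) (hb : ∀ i, b i ∈ wittPiece p (X i) n)
    (h : ∀ i j, wittPairMap p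
      (Algebra.TensorProduct.includeLeft (R := R) (S := R) (A := X i) (B := X j)).toRingHom (b i) =
        wittPairMap p
          (Algebra.TensorProduct.includeRight (R := R) (A := X i) (B := X j)).toRingHom (b j)) :
    ∃ r ∈ wittPiece p R n, ∀ i, wittPairMap p (algebraMap R (X i)) r = b i := by
  rcases lt_or_ge 0 n with hn | hn
  · obtain ⟨m, rfl⟩ : ∃ m : ℕ, n = m + 1 := ⟨(n - 1).toNat, by omega⟩
    obtain ⟨a, ha⟩ := exists_wittVector_of_faithfullyFlat R X (fun i => (b i).2) fun i j =>
      congrArg Prod.snd (h i j)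
    refine ⟨posElt p R m a, posElt_mem m rfl a, fun i => ?_⟩
    rw [wittPairMap_posElt, ha]
    rcases mem_wittPiece_cases (hb i) with ⟨m', c, hm, hc⟩ | ⟨m', c, hm, hc⟩
    · obtain rfl : m = m' := by omega
      rw [hc]
      rfl
    · omega
  · obtain ⟨m, rfl⟩ : ∃ m : ℕ, n = -m := ⟨(-n).toNat, by omega⟩
    obtain ⟨a, ha⟩ := exists_wittVector_of_faithfullyFlat R X (fun i => (b i).1) fun i j =>
      congrArg Prod.fst (h i j)
    refine ⟨negElt p R m a, negElt_mem m rfl a, fun i => ?_⟩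
    rw [wittPairMap_negElt, ha]
    rcases mem_wittPiece_cases (hb i) with ⟨m', c, hm, hc⟩ | ⟨m', c, hm, hc⟩
    · omega
    · obtain rfl : m = m' := by omega
      rw [hc]
      rfl

/-! ### Descent for the graded Witt ring, one degree at a time. -/

namespace GradedWitt

variable (p) in
/-- The homogeneous component of degree `n`, as a pair of Witt vectors. -/
def component {R : Type*} [CommRing R] (n : ℤ) :
    GradedWitt p R →+ WittVector p R × WittVector p R :=
  (wittPiece p R n).subtype.comp (DFinsupp.evalAddMonoidHom (β := fun n => wittPiece p R n) n)

section

variable {R R' : Type*} [CommRing R] [CommRing R']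

theorem component_mem (n : ℤ) (s : GradedWitt p R) : component p n s ∈ wittPiece p R n :=
  Subtype.prop _

theorem component_of (m n : ℤ) (x : wittPiece p R m) :
    component p n (DirectSum.of (fun n => wittPiece p R n) m x) = if m = n then x.1 else 0 := by
  change ((DirectSum.of (fun n => wittPiece p R n) m x) n).1 = _
  rw [DirectSum.of_apply]
  split_ifs with h
  · subst h
    rfl
  · rfl

theorem component_ext {s s' : GradedWitt p R} (h : ∀ n, component p n s = component p n s') :
    s = s' :=
  DFinsupp.ext (β := fun n => wittPiece p R n) fun n => Subtype.ext (h n)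

theorem component_map (φ : R →+* R') (n : ℤ) (s : GradedWitt p R) :
    component p n (GradedWitt.map p φ s) = wittPairMap p φ (component p n s) := by
  refine DFunLike.congr_fun (f := (component p n).comp (GradedWitt.map p φ).toAddMonoidHom)
    (g := (wittPairMap p φ).toAddMonoidHom.comp (component p n)) ?_ s
  refine DirectSum.addHom_ext (β := fun n => wittPiece p R n) fun m x => ?_
  change component p n (GradedWitt.map p φ (DirectSum.of (fun n => wittPiece p R n) m x)) =
    wittPairMap p φ (component p n (DirectSum.of (fun n => wittPiece p R n) m x))
  rw [GradedWitt.map_of]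
  refine (component_of m n _).trans (Eq.trans ?_ (congrArg _ (component_of m n x)).symm)
  split_ifs
  · rfl
  · rw [map_zero]

theorem exists_finset_component (s : GradedWitt p R) :
    ∃ t : Finset ℤ, ∀ n ∉ t, component p n s = 0 := by
  induction s using DirectSum.induction_on with
  | zero => exact ⟨∅, fun n _ => map_zero (component p n)⟩
  | of m x => exact ⟨{m}, fun n hn => (component_of m n x).trans
      (if_neg fun h => hn (Finset.mem_singleton.2 h.symm))⟩
  | add x y hx hy =>
    obtain ⟨t, ht⟩ := hx
    obtain ⟨t', ht'⟩ := hy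
    refine ⟨t ∪ t', fun n hn => ?_⟩
    rw [Finset.mem_union, not_or] at hn
    exact (map_add (component p n) x y).trans 
      ((congrArg₂ (· + ·) (ht n hn.1) (ht' n hn.2)).trans (add_zero 0))

theorem exists_component_eq (t : Finset ℤ) (q : ∀ n, wittPiece p R n) :
    ∃ s : GradedWitt p R, (∀ n ∈ t, component p n s = q n) ∧ ∀ n ∉ t, component p n s = 0 := by
  refine ⟨DirectSum.mk (fun n => wittPiece p R n) t fun n => q n, fun n hn => ?_, fun n hn => ?_⟩
  · change (DirectSum.mk (fun n => wittPiece p R n) t (fun n => q n) n).1 = q n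
    rw [DirectSum.mk_apply_of_mem hn]
  · change (DirectSum.mk (fun n => wittPiece p R n) t (fun n => q n) n).1 = 0
    rw [DirectSum.mk_apply_of_notMem hn]
    rfl

theorem mem_deg_iff {n : ℤ} {s : GradedWitt p R} :
    s ∈ GradedWitt.deg p R n ↔ ∀ m, m ≠ n → component p m s = 0 := by
  constructor
  · rintro ⟨x, rfl⟩ m hm
    exact (component_of n m x).trans (if_neg hm.symm)
  · intro h
    refine ⟨⟨component p n s, component_mem n s⟩, component_ext fun m => ?_⟩
    refine (component_of n m _).trans ?_
    split_ifs with hm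
    · rw [hm]
    · exact (h m (Ne.symm hm)).symm

end

variable (R X) in
theorem component_eq_of_faithfullyFlat [Module.FaithfullyFlat R (∀ i, X i)]
    {s s' : WittVector p R × WittVector p R}
    (h : ∀ i, wittPairMap p (algebraMap R (X i)) s = wittPairMap p (algebraMap R (X i)) s') :
    s = s' :=
  Prod.ext (wittVector_eq_of_faithfullyFlat R X fun i => congrArg Prod.fst (h i))
    (wittVector_eq_of_faithfullyFlat R X fun i => congrArg Prod.snd (h i))

variable (R X) in
theorem eq_of_faithfullyFlat [Module.FaithfullyFlat R (∀ i, X i)] {s s' : GradedWitt p R}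
    (h : ∀ i, GradedWitt.map p (algebraMap R (X i)) s =
      GradedWitt.map p (algebraMap R (X i)) s') : s = s' :=
  component_ext fun n => component_eq_of_faithfullyFlat R X fun i => by
    rw [← component_map, h, component_map]

variable (R X) in
theorem mem_deg_of_faithfullyFlat [Module.FaithfullyFlat R (∀ i, X i)] {s : GradedWitt p R} {n : ℤ}
    (h : ∀ i, GradedWitt.map p (algebraMap R (X i)) s ∈ GradedWitt.deg p (X i) n) :
    s ∈ GradedWitt.deg p R n :=
  mem_deg_iff.2 fun m hm => component_eq_of_faithfullyFlat R X fun i => by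
    rw [← component_map, mem_deg_iff.1 (h i) m hm, map_zero]

variable (R X) in
-- The components glue in every degree. As the index set is finite, the supports of the `b i` have a
-- finite union, outside which the glued element may be taken to be zero.
theorem exists_of_faithfullyFlat [Finite ι] [Module.FaithfullyFlat R (∀ i, X i)]
    (b : ∀ i, GradedWitt p (X i))
    (h : ∀ i j, GradedWitt.map p
      (Algebra.TensorProduct.includeLeft (R := R) (S := R) (A := X i) (B := X j)).toRingHom (b i) =
        GradedWitt.map p
          (Algebra.TensorProduct.includeRight (R := R) (A := X i) (B := X j)).toRingHom (b j)) :
    ∃ s : GradedWitt p R, ∀ i, GradedWitt.map p (algebraMap R (X i)) s = b i := by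
  have := Fintype.ofFinite ι
  choose t ht using fun i => exists_finset_component (b i)
  choose q hq hq' using fun n => exists_wittPiece_of_faithfullyFlat R X n
    (fun i => component p n (b i)) (fun i => component_mem n (b i)) fun i j => by
      rw [← component_map, h, component_map]
  obtain ⟨s, hs, hs'⟩ := exists_component_eq (Finset.univ.biUnion t) fun n => ⟨q n, hq n⟩
  refine ⟨s, fun i => component_ext fun n => ?_⟩
  rw [component_map]
  by_cases hn : n ∈ Finset.univ.biUnion t
  · rw [hs n hn, hq']
  · rw [hs' n hn, map_zero, ht i n fun hi => hn (Finset.mem_biUnion.2 ⟨i, Finset.mem_univ i, hi⟩)]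

end GradedWitt

end Descent

/-! ### The sheaf property and the natural isomorphism. -/

section Sheaf

universe t

open LaurentPolynomial

variable {p : ℕ} [hp : Fact p.Prime] {k : Type a} [Field k]

theorem IsFpqcSheaf.of_iso {F G : Nilp.{a, c} p k ⥤ GrpCat.{t}} (e : F ≅ G)
    (hF : IsFpqcSheaf F) : IsFpqcSheaf G := by
  intro R n X f hf x hx
  have inv_hom : ∀ {Y : Nilp.{a, c} p k} (z : G.obj Y), e.hom.app Y (e.inv.app Y z) = z :=
    fun {Y} z => ConcreteCategory.congr_hom (e.inv_hom_id_app Y) z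
  have hom_inv : ∀ {Y : Nilp.{a, c} p k} (z : F.obj Y), e.inv.app Y (e.hom.app Y z) = z :=
    fun {Y} z => ConcreteCategory.congr_hom (e.hom_inv_id_app Y) z
  have nat_hom : ∀ {Y Z : Nilp.{a, c} p k} (g : Y ⟶ Z) (z : F.obj Y),
      e.hom.app Z (F.map g z) = G.map g (e.hom.app Y z) :=
    fun g z => ConcreteCategory.congr_hom (e.hom.naturality g) z
  have nat_inv : ∀ {Y Z : Nilp.{a, c} p k} (g : Y ⟶ Z) (z : G.obj Y),
      e.inv.app Z (G.map g z) = F.map g (e.inv.app Y z) :=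
    fun g z => ConcreteCategory.congr_hom (e.inv.naturality g) z
  obtain ⟨y, hy, hy'⟩ := hF R n X f hf (fun i => e.inv.app (X i) (x i)) fun i j Y g h hgh => by
    rw [← nat_inv, ← nat_inv, hx i j Y g h hgh]
  refine ⟨e.hom.app R y, fun i => ?_, fun z hz => ?_⟩
  · rw [← nat_hom, hy, inv_hom]
  · rw [← hy' (e.inv.app R z) fun i => by rw [← nat_inv, hz], inv_hom]

variable [CharP k p] [PerfectRing k p] {A : Type b} [CommRing A] [HopfAlgebra ℤ_[p] A]
  (μ : (WittVector p k ⊗[ℤ_[p]] A) →ₐc[WittVector p k] (WittVector p k)[T;T⁻¹])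

/-- By descent `W(R)^⊕` embeds in the product of the `W(X_i)^⊕` with image the compatible families.
A compatible family of points is a homomorphism into the product with values in that image, so it
factors uniquely; preservation of degrees also descends. -/
theorem isFpqcSheaf_displayGroup :
    IsFpqcSheaf (nilpInclusion.{a, c} p k ⋙ displayGroup.{a, b, c} μ) := by
  intro R n X f hf x hx
  let alg : ∀ i, Algebra R.obj (X i).obj := fun i => (f i).hom.hom.toRingHom.toAlgebra
  have tower : ∀ i, IsScalarTower (WittVector p k) R.obj (X i).obj := fun i =>
    .of_algebraMap_eq fun w => ((f i).hom.hom.commutes w).symm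
  have ff : Module.FaithfullyFlat R.obj (∀ i, (X i).obj) :=
    RingHom.faithfullyFlat_algebraMap_iff.1 hf
  let φ : GradedWitt p R.obj →ₐ[WittVector p k] ∀ i, GradedWitt p (X i).obj :=
    AlgHom.pi fun i => GradedWitt.mapAlg p (f i).hom.hom
  have hφ : Function.Injective φ := fun s s' h =>
    GradedWitt.eq_of_faithfullyFlat R.obj (fun i => (X i).obj) fun i => congrFun h i
  let ξ : WittVector p k ⊗[ℤ_[p]] A →ₐ[WittVector p k] ∀ i, GradedWitt p (X i).obj :=
    AlgHom.pi fun i => (x i).down.1.hom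
  have hξ : ∀ z, ξ z ∈ φ.range := by
    intro z
    obtain ⟨s, hs⟩ := GradedWitt.exists_of_faithfullyFlat R.obj (fun i => (X i).obj) (ξ z)
      fun i j => by
        -- The gluing hypothesis is tested on `X_i ⊗_R X_j`, where `p` is nilpotent because it is so
        -- in `X_i`.
        let Y : Nilp.{a, c} p k :=
          { obj := CommAlgCat.of (WittVector p k) ((X i).obj ⊗[R.obj] (X j).obj)
            property := by
              have h := (X i).property.map (Algebra.TensorProduct.includeLeft (R := R.obj)
                (S := R.obj) (A := (X i).obj) (B := (X j).obj))
              rwa [map_natCast] at h }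
        let g : X i ⟶ Y := ObjectProperty.homMk (CommAlgCat.ofHom
          ((Algebra.TensorProduct.includeLeft (R := R.obj) (S := R.obj) (A := (X i).obj)
            (B := (X j).obj)).restrictScalars (WittVector p k)))
        let h : X j ⟶ Y := ObjectProperty.homMk (CommAlgCat.ofHom
          ((Algebra.TensorProduct.includeRight (R := R.obj) (A := (X i).obj)
            (B := (X j).obj)).restrictScalars (WittVector p k)))
        have hgh : f i ≫ g = f j ≫ h := by
          refine ObjectProperty.hom_ext _ (CommAlgCat.hom_ext (AlgHom.ext fun r => ?_))
          change algebraMap R.obj (X i).obj r ⊗ₜ[R.obj] (1 : (X j).obj) =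
            (1 : (X i).obj) ⊗ₜ[R.obj] algebraMap R.obj (X j).obj r
          rw [Algebra.algebraMap_eq_smul_one, TensorProduct.smul_tmul,
            ← Algebra.algebraMap_eq_smul_one]
        have h1 := hx i j Y g h hgh
        exact DFunLike.congr_fun (congrArg (fun q => q.down.1.hom) h1) z
    exact ⟨s, funext hs⟩
  -- The glued point is the product homomorphism `ξ` followed by the inverse of `φ` on its range.
  let e := AlgEquiv.ofInjective φ hφ
  let η : WittVector p k ⊗[ℤ_[p]] A →ₐ[WittVector p k] GradedWitt p R.obj :=
    e.symm.toAlgHom.comp (ξ.codRestrict φ.range hξ)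
  have hη : ∀ z, φ (η z) = ξ z := fun z =>
    congrArg Subtype.val (e.apply_symm_apply ⟨ξ z, hξ z⟩)
  refine ⟨ULift.up ⟨Points.mk η, fun m z hz => ?_⟩, fun i => ?_, fun y hy => ?_⟩
  · refine GradedWitt.mem_deg_of_faithfullyFlat R.obj (fun i => (X i).obj) fun i => ?_
    have h1 : φ (η z) i ∈ GradedWitt.deg p (X i).obj m := by
      rw [hη]
      exact (x i).down.2 m z hz
    exact h1
  · refine ULift.ext _ _ (Subtype.ext (Points.ext (AlgHom.ext fun z => ?_)))
    exact congrFun (hη z) i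
  · refine ULift.ext _ _ (Subtype.ext (Points.ext (AlgHom.ext fun z => hφ (funext fun i => ?_))))
    have h1 := DFunLike.congr_fun (congrArg (fun q => q.down.1.hom) (hy i)) z
    exact h1.trans (congrFun (hη z) i).symm

/-- The isomorphism between the display group and the tensor automorphisms of the canonical graded
fiber functor that sends `h` to the family of its actions. -/
def displayGroupIso [Module.Flat ℤ_[p] A] :
    displayGroup.{a, b, c} μ ≅ tensorAutGroup.{a, b, c} μ :=
  NatIso.ofComponents (fun R => (MulEquiv.ulift.trans (MulEquiv.ofBijective
      (gradedPointsToAut μ (wittDeg p k R)) (gradedPointsToAut_bijective μ _))).toGrpIso)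
    fun {R R'} φ => by
      refine GrpCat.hom_ext (MonoidHom.ext fun h => Subtype.ext (funext fun V =>
        LinearEquiv.toLinearMap_injective (canon_ext fun v => ?_)))
      change V.act (Points.map (GradedWitt.mapAlg p φ.hom) h.down.1) (1 ⊗ₜ (1 ⊗ₜ v)) =
        equivAlong (GradedWitt.mapAlg p φ.hom) (V.actEquiv h.down.1) (1 ⊗ₜ (1 ⊗ₜ v))
      -- The test vectors already come from `R`, where base change of an automorphism and of an
      -- action agree by construction.
      have h1 : (1 : GradedWitt p R') ⊗ₜ[WittVector p k] ((1 : WittVector p k) ⊗ₜ[ℤ_[p]] v) =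
          transfer (V.Base (WittVector p k)) (GradedWitt.mapAlg p φ.hom) (1 ⊗ₜ (1 ⊗ₜ v)) := by
        rw [transfer_tmul, map_one]
      rw [h1, equivAlong_transfer, ← FreeRep.transfer_act]
      rfl

end Sheaf

end GDisplay

end

/-- For a flat affine group scheme `G = Spec A` of finite type over `ℤ_p` and a cocharacter `μ` of
`G` over `W(k)`, the display group `L⁺_μ G` and the functor `Aut^⊗(C_μ)` are fpqc sheaves of groups
on `p`-nilpotent `W(k)`-algebras, and `h ↦ {ρ(h)}` is an isomorphism between them, given by group
isomorphisms that are natural in the `W(k)`-algebra `R`. -/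
theorem theorem3 {p : ℕ} [Fact p.Prime] {k : Type a} [Field k] [Finite k] [CharP k p]
    {A : Type b} [CommRing A] [HopfAlgebra ℤ_[p] A] [Module.Flat ℤ_[p] A]
    [Algebra.FiniteType ℤ_[p] A]
    (μ : (WittVector p k ⊗[ℤ_[p]] A) →ₐc[WittVector p k] (WittVector p k)[T;T⁻¹]) :
    IsFpqcSheaf (nilpInclusion.{a, c} p k ⋙ displayGroup μ) ∧
    IsFpqcSheaf (nilpInclusion.{a, c} p k ⋙ tensorAutGroup μ) ∧
    ∃ Ψ : displayGroup.{a, b, c} μ ≅ tensorAutGroup.{a, b, c} μ,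
      ∀ (R : CommAlgCat.{c} (WittVector p k)) (h : gradedPoints μ (wittDeg p k R))
        (V : FreeRep ℤ_[p] A) (x : V.Canon (WittVector p k) (GradedWitt p R)),
        ((Ψ.hom.app R).hom (ULift.up h)).1 V x = V.act h.1 x :=
  ⟨isFpqcSheaf_displayGroup μ,
    (isFpqcSheaf_displayGroup μ).of_iso
      (Functor.isoWhiskerLeft (nilpInclusion p k) (displayGroupIso μ)),
    displayGroupIso μ, fun _ _ _ _ => rfl⟩
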